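/- Let $Q=\{z\in\mathbb C: e^{-1}\le |z|\le e\}$ be the connector annulus, regarded as the surface pair $(Q,\partial Q)$. A train track in $(Q,\partial Q)$ is a finite system of regular $C^1$ arcs (branches) in $Q$ with embedded, pairwise disjoint interiors lying in $\operatorname{int} Q$. Their ends either meet $\partial Q$ transversely, in pairwise different points, or meet at switches in $\operatorname{int} Q$. At each switch all branches share one tangent line, and there are branches on both sides. For a train track $\tau$ let $\mathscr V(\tau)$ be the cone of non-negative weights on the branches such that at each switch the total weights on the two sides agree, and let $\mathscr{PV}(\tau)=\{w\in\mathscr V(\tau):\sum_b w_b=1\}$ be its projectivization. Call $\tau$ full if $\mathscr V(\tau)$ contains a weight vector that is positive on every branch. Isotopies of train tracks are $C^1$-continuous families of train tracks in $(Q,\partial Q)$ with constant incidence of branches (end points on $\partial Q$ may slide in $\partial Q$). Let $\tau_1$ be the train track that consists of the core circle $|z|=1$, an arc from the outer boundary that merges tangentially with the circle at the switch $1$, and an arc that leaves the circle tangentially at the switch $-1$ towards the inner boundary, such that a smooth path coming from the outer boundary turns counterclockwise along the upper half circle from $1$ to $-1$, where it may leave to the inner boundary. Let $\tau_2$ be the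 mirror image of $\tau_1$ under complex conjugation. Let $\mathscr T$ consist of all full sub-train-tracks of $\tau_1$ and $\tau_2$ (including $\tau_1$ and $\tau_2$). Let $\mathscr M_{\mathscr T}(Q)$ be the quotient space of the disjoint union of the cones $\mathscr V(\tau)$, $\tau\in\mathscr T$, obtained by identifying, whenever two members of $\mathscr T$ share (up to isotopy) a full sub-train-track, the corresponding subcones; let $\mathscr{PM}_{\mathscr T}(Q)$ be constructed in the same way from the $\mathscr{PV}(\tau)$. Then: 1. For $i=1,2$, $\mathscr V(\tau_i)$ is parametrized bijectively by $(t_i,y_i)\in[0,\infty)^2$: both arcs have weight $y_i$, the half circle that a path follows from the outer arc to the inner arc has weight $t_i+y_i$, and the other half circle has weight $t_i$. 2. $\mathscr T$ is a closed collection: all its members are full, and each full sub-train-track of a member is isotopic to a member. 3. $\mathscr{PM}_{\mathscr T}(Q)$ is homeomorphic to $S^1$. 4. There is a piecewise linear homeomorphism $\Phi:\mathscr M_{\mathscr T}(Q)\to\mathbb R^2$ (that is, $\Phi$ is piecewise linear on each cone $\mathscr V(\tau)$, and $\mathbb R^2$ is a finite union of polyhedra on each of which $\Phi^{-1}$ is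 an affine map to one of the cones). The total weight $y$ induced on the outer boundary circle equals that induced on the inner one, is well defined on $\mathscr M_{\mathscr T}(Q)$, and $y\circ\Phi^{-1}$ is a piecewise linear function on $\mathbb R^2$. -/

import Mathlib

open Set Topology

noncomputable section

namespace Lam

/-! ### The connector annulus -/

/-- The connector annulus `Q`, as a closed round annulus around the unit circle. Its distinguished
boundary part `α` is all of `∂Q`, so that `δ` is empty. -/
def connector : Set ℂ := {z | Real.exp (-1) ≤ ‖z‖ ∧ ‖z‖ ≤ Real.exp 1}

def outerBoundary : Set ℂ := {z | ‖z‖ = Real.exp 1}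

def innerBoundary : Set ℂ := {z | ‖z‖ = Real.exp (-1)}

def connectorBoundary : Set ℂ := outerBoundary ∪ innerBoundary

/-! ### Train tracks embedded in the connector

A train track is given by finitely many branches (segments), each a regular `C¹` arc parametrized
by `[0, 1]`. The values of a parametrization outside `[0, 1]` play no role. An end of a branch `b`
is `(b, false)` (at parameter `0`) or `(b, true)` (at parameter `1`). -/

section Curves

variable {B : Type}

def endPoint (c : B → ℝ → ℂ) (e : B × Bool) : ℂ := c e.1 (if e.2 then 1 else 0)

/-- The tangent vector at an end of a branch, pointing into the branch. -/
def endDir (c : B → ℝ → ℂ) (e : B × Bool) : ℂ :=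
  if e.2 then -deriv (c e.1) 1 else deriv (c e.1) 0

/-- Two ends of branches at the same point, leaving it in the same direction. -/
def SameSide (c : B → ℝ → ℂ) (e e' : B × Bool) : Prop :=
  endPoint c e' = endPoint c e ∧ SameRay ℝ (endDir c e) (endDir c e')

/-- Two ends of branches at the same point, leaving it in opposite directions. -/
def OppositeSide (c : B → ℝ → ℂ) (e e' : B × Bool) : Prop :=
  endPoint c e' = endPoint c e ∧ SameRay ℝ (endDir c e) (-endDir c e')

/-- The arcs `c b`, `b : B`, are the branches of a train track `(τ, ∂τ) ↪ (Q, ∂Q)`. The switches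
are the end points of branches that do not lie on `∂Q`. -/
structure IsTrainTrack (c : B → ℝ → ℂ) : Prop where
  contDiff : ∀ b, ContDiff ℝ 1 (c b)
  immersed : ∀ b, ∀ u ∈ Icc (0 : ℝ) 1, deriv (c b) u ≠ 0
  mem_connector : ∀ b, ∀ u ∈ Icc (0 : ℝ) 1, c b u ∈ connector
  /-- branches meet the boundary of the annulus at most in their end points -/
  interior : ∀ b, ∀ u ∈ Ioo (0 : ℝ) 1, c b u ∉ connectorBoundary
  /-- the open branches are embedded, disjoint from each other and from all end points -/
  embedded : ∀ b b', ∀ u ∈ Ioo (0 : ℝ) 1, ∀ v ∈ Icc (0 : ℝ) 1, c b u = c b' v → b = b' ∧ u = v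
  /-- the track meets `∂Q` transversely (the radial component of the tangent is not zero) -/
  transverse : ∀ e, endPoint c e ∈ connectorBoundary → inner ℝ (endPoint c e) (endDir c e) ≠ 0
  /-- different ends of branches meet `∂Q` in different points -/
  boundary_inj : ∀ e e', endPoint c e ∈ connectorBoundary → endPoint c e' = endPoint c e → e' = e
  /-- all branches at a switch have the same tangent line there -/
  tangent : ∀ e e', endPoint c e' = endPoint c e → SameSide c e e' ∨ OppositeSide c e e'
  /-- there are branches on both sides of each switch -/
  two_sided : ∀ e, endPoint c e ∉ connectorBoundary → ∃ e', OppositeSide c e e'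

end Curves

/-- A train track embedded in the connector annulus `(Q, ∂Q)`. -/
structure TrainTrack where
  Branch : Type
  fintypeBranch : Fintype Branch
  curve : Branch → ℝ → ℂ
  isTrainTrack : IsTrainTrack curve

attribute [instance] TrainTrack.fintypeBranch

namespace TrainTrack

open Classical in
/-- The cone `𝒱(τ)` of invariant weight vectors: non-negative weights on the branches such that at
each switch the total weights on the two sides agree. -/
def weightCone (τ : TrainTrack) : Set (τ.Branch → ℝ) :=
  {w | (∀ b, 0 ≤ w b) ∧
    ∀ e : τ.Branch × Bool, endPoint τ.curve e ∉ connectorBoundary →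
      ∑ e' : τ.Branch × Bool with SameSide τ.curve e e', w e'.1 =
        ∑ e' : τ.Branch × Bool with OppositeSide τ.curve e e', w e'.1}

/-- The projectivized cone `𝒫𝒱(τ)`, as a convex polyhedron in the standard simplex. -/
def projWeightCone (τ : TrainTrack) : Set (τ.Branch → ℝ) :=
  {w | w ∈ τ.weightCone ∧ ∑ b, w b = 1}

open Classical in
/-- The weight that `w` induces on the part `X` of the boundary of the annulus. -/
def boundaryWeight (τ : TrainTrack) (X : Set ℂ) (w : τ.Branch → ℝ) : ℝ :=
  ∑ e : τ.Branch × Bool with endPoint τ.curve e ∈ X, w e.1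

/-- `τ` is full: some measured lamination is carried by `τ` with positive weight on each branch. -/
def IsFull (τ : TrainTrack) : Prop := ∃ w ∈ τ.weightCone, ∀ b, 0 < w b

/-- The union of a set of branches is a sub-train-track if it is itself a train track. -/
def IsSubtrack (τ : TrainTrack) (A : Finset τ.Branch) : Prop :=
  IsTrainTrack fun b : A => τ.curve b

def sub (τ : TrainTrack) (A : Finset τ.Branch) (h : τ.IsSubtrack A) : TrainTrack where
  Branch := A
  fintypeBranch := inferInstance
  curve b := τ.curve b
  isTrainTrack := h

def IsFullSubtrack (τ : TrainTrack) (A : Finset τ.Branch) : Prop :=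
  ∃ h : τ.IsSubtrack A, (τ.sub A h).IsFull

/-- An isotopy in `(Q, ∂Q)` from `σ` to `τ`: a `C¹`-continuous family of embedded train tracks with
constant incidence of branches, which starts with `σ` and ends with `τ`. End points on `∂Q` may
move in `∂Q`. At the end, branches are matched as subsets of the annulus. -/
structure Isotopy (σ τ : TrainTrack) where
  family : ℝ → σ.Branch → ℝ → ℂ
  branchEquiv : σ.Branch ≃ τ.Branch
  isTrainTrack : ∀ s ∈ Icc (0 : ℝ) 1, IsTrainTrack (family s)
  continuousOn : ∀ b,
    ContinuousOn (fun p : ℝ × ℝ => family p.1 b p.2) (Icc (0 : ℝ) 1 ×ˢ Icc (0 : ℝ) 1)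
  continuousOn_deriv : ∀ b,
    ContinuousOn (fun p : ℝ × ℝ => deriv (family p.1 b) p.2) (Icc (0 : ℝ) 1 ×ˢ Icc (0 : ℝ) 1)
  incidence : ∀ s ∈ Icc (0 : ℝ) 1, ∀ e e',
    endPoint (family s) e = endPoint (family s) e' ↔ endPoint σ.curve e = endPoint σ.curve e'
  start : ∀ b, ∀ u ∈ Icc (0 : ℝ) 1, family 0 b u = σ.curve b u
  finish : ∀ b, family 1 b '' Icc 0 1 = τ.curve (branchEquiv b) '' Icc 0 1

end TrainTrack

/-! ### Collections of train tracks and their lamination spaces -/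

section Collections

variable {ι : Type} (𝒯 : ι → TrainTrack)

/-- A collection of full train tracks is closed if it contains, up to isotopy, all full
sub-train-tracks of its members. -/
def IsClosedCollection : Prop :=
  (∀ i, (𝒯 i).IsFull) ∧
    ∀ i (A : Finset (𝒯 i).Branch) (h : (𝒯 i).IsSubtrack A), ((𝒯 i).sub A h).IsFull →
      ∃ j, Nonempty (((𝒯 i).sub A h).Isotopy (𝒯 j))

/-- The weight vectors `v` on `𝒯 i` and `w` on `𝒯 j` come from the same weight vector on a full
sub-train-track that `𝒯 i` and `𝒯 j` share up to isotopy. -/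
def Glue (i j : ι) (v : (𝒯 i).Branch → ℝ) (w : (𝒯 j).Branch → ℝ) : Prop :=
  ∃ (A : Finset (𝒯 i).Branch) (B : Finset (𝒯 j).Branch)
    (hA : (𝒯 i).IsSubtrack A) (hB : (𝒯 j).IsSubtrack B)
    (φ : ((𝒯 i).sub A hA).Isotopy ((𝒯 j).sub B hB)),
    ((𝒯 i).sub A hA).IsFull ∧ ((𝒯 j).sub B hB).IsFull ∧
    (∀ b, b ∉ A → v b = 0) ∧ (∀ b, b ∉ B → w b = 0) ∧
    ∀ a : A, w (show B from φ.branchEquiv a).1 = v a.1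

/-- `ℳ_𝒯`: the disjoint union of the cones `𝒱(τ)`, `τ ∈ 𝒯`, glued along the subcones of common
full sub-train-tracks, with the quotient topology. (`Quot` is the quotient by the equivalence
relation generated by the given one.) -/
def MLSpace : Type :=
  Quot fun x y : Σ i, (𝒯 i).weightCone => Glue 𝒯 x.1 y.1 (x.2 : _ → ℝ) (y.2 : _ → ℝ)

instance : TopologicalSpace (MLSpace 𝒯) :=
  inferInstanceAs (TopologicalSpace (Quot _))

/-- `𝒫ℳ_𝒯`: the same construction with the polyhedra `𝒫𝒱(τ)`. -/
def PMLSpace : Type :=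
  Quot fun x y : Σ i, (𝒯 i).projWeightCone => Glue 𝒯 x.1 y.1 (x.2 : _ → ℝ) (y.2 : _ → ℝ)

instance : TopologicalSpace (PMLSpace 𝒯) :=
  inferInstanceAs (TopologicalSpace (Quot _))

/-- The measured lamination `τ(w)`, as a point of `ℳ_𝒯`. -/
def MLSpace.mk (i : ι) (w : (𝒯 i).weightCone) : MLSpace 𝒯 := Quot.mk _ ⟨i, w⟩

end Collections

/-- The collection of all full sub-train-tracks of the given train tracks. -/
def fullSubtracks {κ : Type} (τ : κ → TrainTrack) :
    (Σ k, {A : Finset (τ k).Branch // (τ k).IsFullSubtrack A}) → TrainTrack :=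
  fun x => (τ x.1).sub x.2.1 x.2.2.1

/-! ### Piecewise linear maps -/

section PL

variable {E F : Type} [NormedAddCommGroup E] [NormedSpace ℝ E]
  [NormedAddCommGroup F] [NormedSpace ℝ F]

/-- A (convex) polyhedron: the intersection of finitely many closed half-spaces. -/
def IsPolyhedron (P : Set E) : Prop :=
  ∃ H : Finset ((E →L[ℝ] ℝ) × ℝ), P = {x | ∀ h ∈ H, h.1 x ≤ h.2}

/-- `f : X → F` is piecewise linear: it is continuous, and `X` is a finite union of polyhedra on
each of which `f` is affine. -/
def IsPiecewiseLinear {X : Set E} (f : X → F) : Prop :=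
  Continuous f ∧ ∃ 𝒬 : Finset (Set E), (∀ P ∈ 𝒬, IsPolyhedron P) ∧ (⋃ P ∈ 𝒬, P) = X ∧
    ∀ P ∈ 𝒬, ∃ L : E →ᵃ[ℝ] F, ∀ x : X, (x : E) ∈ P → f x = L x

/-- A homeomorphism `ℳ_𝒯 ≃ E` is piecewise linear: it is piecewise linear on each cone `𝒱(τ)`, and
`E` is a finite union of polyhedra on each of which the inverse is an affine map to some cone. -/
def IsPLHomeomorph {ι : Type} {𝒯 : ι → TrainTrack} (Φ : MLSpace 𝒯 ≃ₜ E) : Prop :=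
  (∀ i, IsPiecewiseLinear fun w : (𝒯 i).weightCone => Φ (MLSpace.mk 𝒯 i w)) ∧
    ∃ 𝒬 : Finset (Set E), (∀ P ∈ 𝒬, IsPolyhedron P) ∧ (⋃ P ∈ 𝒬, P) = univ ∧
      ∀ P ∈ 𝒬, ∃ (i : ι) (L : E →ᵃ[ℝ] ((𝒯 i).Branch → ℝ)), ∀ x ∈ P,
        ∃ h : L x ∈ (𝒯 i).weightCone, Φ.symm x = MLSpace.mk 𝒯 i ⟨L x, h⟩

end PL

/-! ### The two standard train tracks in the connector

Both consist of the core circle, divided by the switches `1` and `-1` into two half circles, an arc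
from the outer boundary which merges tangentially with the circle at `1`, and an arc which leaves
the circle tangentially at `-1` towards the inner boundary. A path that comes in from the outer
boundary turns counterclockwise in one of the tracks and clockwise in the other one; `long` is the
half circle that it runs along to get from `1` to `-1`, and `short` the other half circle. -/

inductive ConnectorBranch
  | outer | inner | long | short
  deriving DecidableEq

instance : Fintype ConnectorBranch :=
  ⟨{.outer, .inner, .long, .short}, fun b => by cases b <;> decide⟩

/-- The point with polar coordinates `(exp s, θ)`. -/
def polar (s θ : ℝ) : ℂ := Complex.exp (s + θ * Complex.I)

/-- The sense of turning: counterclockwise for `false`, clockwise for `true`. -/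
def turn (k : Bool) : ℝ := if k then -1 else 1

def connectorCurve (k : Bool) : ConnectorBranch → ℝ → ℂ
  | .outer => fun u => polar (u ^ 2) (turn k * -u)
  | .inner => fun u => polar (-u ^ 2) (turn k * (Real.pi + u))
  | .long => fun u => polar 0 (turn k * (Real.pi * u))
  | .short => fun u => polar 0 (turn k * (Real.pi * (1 + u)))

theorem norm_polar (s θ : ℝ) : ‖polar s θ‖ = Real.exp s := by
  simp [polar, Complex.norm_exp]

theorem polar_im (s θ : ℝ) : (polar s θ).im = Real.exp s * Real.sin θ := by
  simp [polar, Complex.exp_im]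

theorem polar_re (s θ : ℝ) : (polar s θ).re = Real.exp s * Real.cos θ := by
  simp [polar, Complex.exp_re]

theorem turn_cases (k : Bool) : turn k = 1 ∨ turn k = -1 := by
  cases k <;> simp [turn]

theorem polar_ne_zero (s θ : ℝ) : polar s θ ≠ 0 := Complex.exp_ne_zero _

theorem hasDerivAt_polar {f g : ℝ → ℝ} {f' g' u : ℝ} (hf : HasDerivAt f f' u)
    (hg : HasDerivAt g g' u) :
    HasDerivAt (fun u => polar (f u) (g u)) (polar (f u) (g u) * (f' + g' * Complex.I)) u := by
  have := ((hf.ofReal_comp).add ((hg.ofReal_comp).mul_const Complex.I)).cexp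
  exact this

theorem contDiff_polar {f g : ℝ → ℝ} (hf : ContDiff ℝ 1 f) (hg : ContDiff ℝ 1 g) :
    ContDiff ℝ 1 (fun u => polar (f u) (g u)) := by
  have h : ContDiff ℝ 1 (fun x : ℝ => (x : ℂ)) := Complex.ofRealCLM.contDiff
  exact ((h.comp hf).add ((h.comp hg).mul contDiff_const)).cexp

/-- The logarithmic radial velocity and the angular velocity of the branches. -/
def radialSpeed : ConnectorBranch → ℝ → ℝ
  | .outer, u => 2 * u
  | .inner, u => -(2 * u)
  | .long, _ => 0
  | .short, _ => 0

def angularSpeed (k : Bool) : ConnectorBranch → ℝ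
  | .outer => -turn k
  | .inner => turn k
  | .long => turn k * Real.pi
  | .short => turn k * Real.pi

theorem deriv_connectorCurve (k : Bool) (b : ConnectorBranch) (u : ℝ) :
    deriv (connectorCurve k b) u =
      connectorCurve k b u * (radialSpeed b u + angularSpeed k b * Complex.I) := by
  have hi := hasDerivAt_id u
  have hsq : HasDerivAt (fun u : ℝ => u ^ 2) (2 * u) u := by simpa using hasDerivAt_pow 2 u
  cases b
  · have hg : HasDerivAt (fun u : ℝ => turn k * -u) (-turn k) u := by
      simpa using hi.neg.const_mul (turn k)
    exact (hasDerivAt_polar hsq hg).deriv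
  · have hg : HasDerivAt (fun u : ℝ => turn k * (Real.pi + u)) (turn k) u := by
      simpa using (hi.const_add Real.pi).const_mul (turn k)
    exact (hasDerivAt_polar hsq.neg hg).deriv
  · have hg : HasDerivAt (fun u : ℝ => turn k * (Real.pi * u)) (turn k * Real.pi) u := by
      simpa using (hi.const_mul Real.pi).const_mul (turn k)
    exact (hasDerivAt_polar (hasDerivAt_const u (0 : ℝ)) hg).deriv
  · have hg : HasDerivAt (fun u : ℝ => turn k * (Real.pi * (1 + u))) (turn k * Real.pi) u := by
      simpa using ((hi.const_add 1).const_mul Real.pi).const_mul (turn k)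
    exact (hasDerivAt_polar (hasDerivAt_const u (0 : ℝ)) hg).deriv

theorem norm_connectorCurve (k : Bool) (b : ConnectorBranch) (u : ℝ) :
    ‖connectorCurve k b u‖ = Real.exp (match b with
      | .outer => u ^ 2 | .inner => -u ^ 2 | .long => 0 | .short => 0) := by
  cases b <;> exact norm_polar _ _

theorem im_long (k : Bool) (u : ℝ) :
    (connectorCurve k .long u).im = turn k * Real.sin (Real.pi * u) := by
  rw [connectorCurve, polar_im]
  rcases turn_cases k with h | h <;> simp [h]

theorem im_short (k : Bool) (u : ℝ) :
    (connectorCurve k .short u).im = -(turn k * Real.sin (Real.pi * u)) := by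
  have h1 : Real.sin (Real.pi * (1 + u)) = -Real.sin (Real.pi * u) := by
    rw [mul_add, mul_one, add_comm, Real.sin_add_pi]
  rw [connectorCurve, polar_im]
  rcases turn_cases k with h | h <;> simp [h, h1]

theorem re_long (k : Bool) (u : ℝ) :
    (connectorCurve k .long u).re = Real.cos (Real.pi * u) := by
  rw [connectorCurve, polar_re]
  rcases turn_cases k with h | h <;> simp [h]

theorem re_short (k : Bool) (u : ℝ) :
    (connectorCurve k .short u).re = -Real.cos (Real.pi * u) := by
  have h1 : Real.cos (Real.pi * (1 + u)) = -Real.cos (Real.pi * u) := by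
    rw [mul_add, mul_one, add_comm, Real.cos_add_pi]
  rw [connectorCurve, polar_re]
  rcases turn_cases k with h | h <;> simp [h, h1]

theorem outer_zero (k : Bool) : connectorCurve k .outer 0 = 1 := by
  simp [connectorCurve, polar]

theorem inner_zero (k : Bool) : connectorCurve k .inner 0 = -1 := by
  rcases turn_cases k with h | h <;> simp [connectorCurve, polar, h, Complex.exp_neg]

theorem long_zero (k : Bool) : connectorCurve k .long 0 = 1 := by
  simp [connectorCurve, polar]

theorem long_one (k : Bool) : connectorCurve k .long 1 = -1 := by
  apply Complex.ext <;> simp [re_long, im_long]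

theorem short_zero (k : Bool) : connectorCurve k .short 0 = -1 := by
  apply Complex.ext <;> simp [re_short, im_short]

theorem short_one (k : Bool) : connectorCurve k .short 1 = 1 := by
  apply Complex.ext <;> simp [re_short, im_short]

/-- The velocity at an end of a branch at a switch is this multiple of `i` (up to `turn k`). -/
def endSpeed : ConnectorBranch × Bool → ℝ
  | (.outer, _) => -1
  | (.inner, _) => -1
  | (.long, _) => Real.pi
  | (.short, _) => -Real.pi

theorem sameRay_mul_I {a b : ℝ} (h : 0 < a * b) :
    SameRay ℝ ((a : ℂ) * Complex.I) ((b : ℂ) * Complex.I) := by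
  have hab : SameRay ℝ a b := by
    rcases pos_and_pos_or_neg_and_neg_of_mul_pos h with ⟨ha, hb⟩ | ⟨ha, hb⟩
    · exact Or.inr (Or.inr ⟨b, a, hb, ha, by simp [mul_comm]⟩)
    · exact Or.inr (Or.inr ⟨-b, -a, by linarith, by linarith, by simp [mul_comm]⟩)
  have := hab.map (LinearMap.toSpanSingleton ℝ ℂ Complex.I)
  simpa using this

theorem mem_boundary_iff (k : Bool) (e : ConnectorBranch × Bool) :
    endPoint (connectorCurve k) e ∈ connectorBoundary ↔ e = (.outer, true) ∨ e = (.inner, true) := by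
  have h1 : (1 : ℝ) ≠ Real.exp 1 := by
    intro h
    have := (Real.exp_eq_one_iff 1).1 h.symm
    norm_num at this
  have h2 : (1 : ℝ) ≠ Real.exp (-1) := by
    intro h
    have := (Real.exp_eq_one_iff (-1)).1 h.symm
    norm_num at this
  rcases e with ⟨b, _ | _⟩ <;> cases b <;>
    simp [endPoint, connectorBoundary, outerBoundary, innerBoundary, norm_connectorCurve, h1, h2]

theorem endDir_switch (k : Bool) (e : ConnectorBranch × Bool)
    (he : endPoint (connectorCurve k) e ∉ connectorBoundary) :
    endDir (connectorCurve k) e = ((turn k * endSpeed e : ℝ) : ℂ) * Complex.I := by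
  rw [mem_boundary_iff] at he
  rcases e with ⟨b, _ | _⟩ <;> cases b <;>
    simp [endDir, deriv_connectorCurve, outer_zero, inner_zero, long_zero, long_one, short_zero,
      short_one, radialSpeed, angularSpeed, endSpeed] at he ⊢

theorem turn_mul_self (k : Bool) : turn k * turn k = 1 := by
  rcases turn_cases k with h | h <;> simp [h]

theorem sameRay_endDir (k : Bool) (e e' : ConnectorBranch × Bool)
    (he : endPoint (connectorCurve k) e ∉ connectorBoundary)
    (he' : endPoint (connectorCurve k) e' ∉ connectorBoundary)
    (h : 0 < endSpeed e * endSpeed e') :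
    SameRay ℝ (endDir (connectorCurve k) e) (endDir (connectorCurve k) e') := by
  rw [endDir_switch k e he, endDir_switch k e' he']
  apply sameRay_mul_I
  have : turn k * endSpeed e * (turn k * endSpeed e') =
    turn k * turn k * (endSpeed e * endSpeed e') := by ring
  rw [this, turn_mul_self, one_mul]
  exact h

theorem sameRay_neg_endDir (k : Bool) (e e' : ConnectorBranch × Bool)
    (he : endPoint (connectorCurve k) e ∉ connectorBoundary)
    (he' : endPoint (connectorCurve k) e' ∉ connectorBoundary)
    (h : endSpeed e * endSpeed e' < 0) :
    SameRay ℝ (endDir (connectorCurve k) e) (-endDir (connectorCurve k) e') := by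
  rw [endDir_switch k e he, endDir_switch k e' he']
  have : turn k * endSpeed e * -(turn k * endSpeed e') =
    turn k * turn k * -(endSpeed e * endSpeed e') := by ring
  have h2 := @sameRay_mul_I (turn k * endSpeed e) (-(turn k * endSpeed e'))
    (by rw [this, turn_mul_self, one_mul]; linarith)
  simpa using h2

theorem endSpeed_ne_zero (e : ConnectorBranch × Bool) : endSpeed e ≠ 0 := by
  rcases e with ⟨b, _ | _⟩ <;> cases b <;> simp [endSpeed, Real.pi_ne_zero]

theorem sin_pi_mul_pos {u : ℝ} (hu : u ∈ Ioo (0 : ℝ) 1) : 0 < Real.sin (Real.pi * u) :=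
  Real.sin_pos_of_pos_of_lt_pi (mul_pos Real.pi_pos hu.1) (by nlinarith [Real.pi_pos, hu.2])

theorem sin_pi_mul_nonneg {u : ℝ} (hu : u ∈ Icc (0 : ℝ) 1) : 0 ≤ Real.sin (Real.pi * u) :=
  Real.sin_nonneg_of_nonneg_of_le_pi (mul_nonneg Real.pi_pos.le hu.1)
    (by nlinarith [Real.pi_pos, hu.2])

theorem cos_pi_mul_inj {u v : ℝ} (hu : u ∈ Icc (0 : ℝ) 1) (hv : v ∈ Icc (0 : ℝ) 1)
    (h : Real.cos (Real.pi * u) = Real.cos (Real.pi * v)) : u = v := by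
  have hp := Real.pi_pos
  have := Real.injOn_cos ⟨mul_nonneg hp.le hu.1, by nlinarith [hu.2]⟩
    ⟨mul_nonneg hp.le hv.1, by nlinarith [hv.2]⟩ h
  exact mul_left_cancel₀ hp.ne' this

theorem connectorCurve_embedded (k : Bool) (b b' : ConnectorBranch) (u : ℝ)
    (hu : u ∈ Ioo (0 : ℝ) 1) (v : ℝ) (hv : v ∈ Icc (0 : ℝ) 1)
    (h : connectorCurve k b u = connectorCurve k b' v) : b = b' ∧ u = v := by
  have hn := congrArg norm h
  have hre := congrArg Complex.re h
  have him := congrArg Complex.im h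
  have hu2 : 0 < u ^ 2 := pow_pos hu.1 2
  have hv2 : 0 ≤ v ^ 2 := sq_nonneg v
  have hs := sin_pi_mul_pos hu
  have hsv := sin_pi_mul_nonneg hv
  have ht := turn_mul_self k
  have hu' : u ∈ Icc (0 : ℝ) 1 := ⟨hu.1.le, hu.2.le⟩
  have ht0 : turn k ≠ 0 := by rintro h0; simp [h0] at ht
  rw [norm_connectorCurve, norm_connectorCurve, Real.exp_eq_exp] at hn
  have sq0 : v ^ 2 = 0 → v = 0 := fun h => by simpa using h
  have sqi : u ^ 2 = v ^ 2 → u = v := fun h => by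
    rwa [sq_eq_sq₀ hu.1.le hv.1] at h
  cases b <;> cases b' <;> simp only at hn
  · exact ⟨rfl, sqi hn⟩
  · linarith
  · linarith
  · linarith
  · linarith
  · exact ⟨rfl, sqi (by linarith)⟩
  · linarith
  · linarith
  · have := sq0 hn.symm; subst this
    rw [im_long, outer_zero] at him
    simp [ht0, hs.ne'] at him
  · have := sq0 (by linarith); subst this
    rw [im_long, inner_zero] at him
    simp [ht0, hs.ne'] at him
  · rw [re_long, re_long] at hre
    exact ⟨rfl, cos_pi_mul_inj hu' hv hre⟩
  · rw [im_long, im_short, ← mul_neg] at him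
    have := mul_left_cancel₀ ht0 him
    linarith
  · have := sq0 hn.symm; subst this
    rw [im_short, outer_zero] at him
    simp [ht0, hs.ne'] at him
  · have := sq0 (by linarith); subst this
    rw [im_short, inner_zero] at him
    simp [ht0, hs.ne'] at him
  · rw [im_long, im_short, ← mul_neg] at him
    have := mul_left_cancel₀ ht0 him
    linarith
  · rw [re_short, re_short] at hre
    exact ⟨rfl, cos_pi_mul_inj hu' hv (neg_injective hre)⟩

theorem connectorCurve_isTrainTrack (k : Bool) : IsTrainTrack (connectorCurve k) where
  contDiff b := by
    cases b <;> exact contDiff_polar (by fun_prop) (by fun_prop)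
  immersed b u hu := by
    rw [deriv_connectorCurve]
    refine mul_ne_zero ?_ ?_
    · cases b <;> exact polar_ne_zero _ _
    · intro h
      have h2 := congrArg Complex.im h
      rcases turn_cases k with ht | ht <;> cases b <;>
        simp [angularSpeed, ht, Real.pi_ne_zero] at h2
  mem_connector b u hu := by
    have h1 : u ^ 2 ≤ 1 := by nlinarith [hu.1, hu.2]
    have h2 := sq_nonneg u
    simp only [connector, mem_ofPred_eq, norm_connectorCurve, Real.exp_le_exp]
    cases b <;> constructor <;> simp only <;> linarith
  interior b u hu := by
    have h1 : u ^ 2 < 1 := by nlinarith [hu.1, hu.2]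
    have h2 := sq_nonneg u
    simp only [connectorBoundary, outerBoundary, innerBoundary, mem_union, mem_ofPred_eq,
      norm_connectorCurve, Real.exp_eq_exp]
    rintro (h | h) <;> cases b <;> simp only at h <;> linarith
  embedded b b' u hu v hv h := connectorCurve_embedded k b b' u hu v hv h
  transverse e he := by
    have key : ∀ (z : ℂ) (r a : ℝ), z ≠ 0 → r ≠ 0 →
        inner ℝ z (-(z * (r + a * Complex.I))) ≠ 0 := by
      intro z r a hz hr
      have : inner ℝ z (-(z * (r + a * Complex.I))) = -(r * Complex.normSq z) := by
        simp [Complex.inner, Complex.normSq_apply]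
        ring
      rw [this]
      exact neg_ne_zero.2 (mul_ne_zero hr (by simpa using hz))
    rcases (mem_boundary_iff k e).1 he with rfl | rfl
    · simp only [endPoint, endDir, if_true, deriv_connectorCurve]
      exact key _ _ _ (polar_ne_zero _ _) (by simp [radialSpeed])
    · simp only [endPoint, endDir, if_true, deriv_connectorCurve]
      exact key _ _ _ (polar_ne_zero _ _) (by simp [radialSpeed])
  boundary_inj e e' he h := by
    have he' := he
    rw [← h] at he'
    have hn := congrArg norm h
    rcases (mem_boundary_iff k e).1 he with rfl | rfl <;>
      rcases (mem_boundary_iff k e').1 he' with rfl | rfl <;> try rfl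
    all_goals
      simp only [endPoint, if_true, norm_connectorCurve, Real.exp_eq_exp] at hn
      norm_num at hn
  tangent e e' h := by
    by_cases he : endPoint (connectorCurve k) e ∈ connectorBoundary
    · have he' := he
      rw [← h] at he'
      have hn := congrArg norm h
      left
      rcases (mem_boundary_iff k e).1 he with rfl | rfl <;>
        rcases (mem_boundary_iff k e').1 he' with rfl | rfl <;>
        first
        | exact ⟨rfl, SameRay.refl _⟩
        | (simp only [endPoint, if_true, norm_connectorCurve, Real.exp_eq_exp] at hn
           norm_num at hn)
    · have he' := he
      rw [← h] at he'
      rcases lt_or_gt_of_ne (mul_ne_zero (endSpeed_ne_zero e) (endSpeed_ne_zero e')) with h0 | h0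
      · exact Or.inr ⟨h, sameRay_neg_endDir k e e' he he' h0⟩
      · exact Or.inl ⟨h, sameRay_endDir k e e' he he' h0⟩
  two_sided e he := by
    have key : ∀ e', endPoint (connectorCurve k) e' = endPoint (connectorCurve k) e →
        endSpeed e * endSpeed e' < 0 → ∃ e', OppositeSide (connectorCurve k) e e' :=
      fun e' h h0 => ⟨e', h, sameRay_neg_endDir k e e' he (by rwa [h]) h0⟩
    have hp := Real.pi_pos
    have hb := mt (mem_boundary_iff k e).2 he
    rcases e with ⟨b, _ | _⟩ <;> cases b
    · exact key (.long, false) (by simp [endPoint, outer_zero, long_zero])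
        (by simp only [endSpeed]; nlinarith)
    · exact key (.long, true) (by simp [endPoint, inner_zero, long_one])
        (by simp only [endSpeed]; nlinarith)
    · exact key (.outer, false) (by simp [endPoint, outer_zero, long_zero])
        (by simp only [endSpeed]; nlinarith)
    · exact key (.long, true) (by simp [endPoint, short_zero, long_one])
        (by simp only [endSpeed]; nlinarith)
    · simp at hb
    · simp at hb
    · exact key (.inner, false) (by simp [endPoint, inner_zero, long_one])
        (by simp only [endSpeed]; nlinarith)
    · exact key (.long, false) (by simp [endPoint, short_one, long_zero])
        (by simp only [endSpeed]; nlinarith)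

/-- The two standard train tracks in the connector annulus. -/
def connectorTrack (k : Bool) : TrainTrack where
  Branch := ConnectorBranch
  fintypeBranch := inferInstance
  curve := connectorCurve k
  isTrainTrack := connectorCurve_isTrainTrack k

/-- The weights on the branches of a standard train track with parameters `(t, y)`. -/
def connectorWeight (t y : ℝ) : ConnectorBranch → ℝ
  | .outer => y
  | .inner => y
  | .long => t + y
  | .short => t

/-- The two standard train tracks together with all their full sub-train-tracks. -/
abbrev connectorCollection := fullSubtracks connectorTrack

end Lam

/-! Extending weights by zero turns a weight vector on any member of the collection into a vector on
the four branches of a standard track. The switch conditions then say that it is `connectorWeight t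
y`, where `t` is the weight of the short half circle and `y` that of the arcs (`mem_weightCone_sub`,
`isBalanced_iff`). Each member is glued into the full track that contains it (`glue_whole`), so no
list of the full sub-train-tracks is needed: both glued spaces are quotients of two copies of a
quadrant, or of a segment in it.

The two quadrants are glued along both axes. For `y = 0` the tracks share the core circle as a set
(`coreIsotopy`). For `t = 0` both reduce to an arc across the annulus, and the two arcs become
isotopic by making them strictly monotone in the radial direction while they unwind (`arcIsotopy`).
Two quadrants glued along their boundary rays form a plane: `(t, y) ↦ (t - y, ± min t y)` maps them
to the upper and the lower half plane.

The main point is that nothing else is glued (`Glue.coord_eq`). The largest weight `t + y` and the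
total weight `2 t + 3 y` survive each gluing, so `(t, y)` does too (`Glue.ext_eq`). If `t` and `y`
are both positive, the common sub-train-track is everything, and the isotopy must match the long
half circles because they alone carry `t + y`. The loop along the long and then the short half
circle has winding number `1` in one track and `-1` in the other, and winding numbers are constant
along isotopies; hence the two tracks are the same (`turn_eq_of_isotopy`, `Glue.index_eq`).

Projectively, the image in the plane is the level set where the total weight is `1`. This function
is positively homogeneous and positive off the origin, so radial projection identifies the level set
with the circle. Piecewise linearity holds because the coordinates are linear on either side of `t =
y`, and `t` and `y` are linear on each quadrant of the plane. -/

namespace Lam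

/-! ### Train tracks and isotopies -/

section Curves

variable {B B' : Type} {c : B → ℝ → ℂ}

/-- Every condition on a train track except two-sidedness is inherited by subfamilies of branches,
so only that one has to be supplied. -/
theorem IsTrainTrack.comp_injective (h : IsTrainTrack c) {f : B' → B} (hf : Function.Injective f)
    (h2 : ∀ e, endPoint (fun b => c (f b)) e ∉ connectorBoundary →
      ∃ e', OppositeSide (fun b => c (f b)) e e') :
    IsTrainTrack fun b => c (f b) where
  contDiff b := h.contDiff (f b)
  immersed b := h.immersed (f b)
  mem_connector b := h.mem_connector (f b)
  interior b := h.interior (f b)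
  embedded b b' u hu v hv hb :=
    (h.embedded (f b) (f b') u hu v hv hb).imp (fun h => hf h) id
  transverse e := h.transverse (f e.1, e.2)
  boundary_inj e e' he hee := by
    have := h.boundary_inj (f e.1, e.2) (f e'.1, e'.2) he hee
    exact Prod.ext (hf (congrArg (fun p : B × Bool => p.1) this))
      (congrArg (fun p : B × Bool => p.2) this)
  tangent e e' := h.tangent (f e.1, e.2) (f e'.1, e'.2)
  two_sided := h2

theorem IsTrainTrack.comp_equiv (h : IsTrainTrack c) (f : B' ≃ B) :
    IsTrainTrack fun b => c (f b) :=
  h.comp_injective f.injective fun e he => by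
    obtain ⟨e', he'⟩ := h.two_sided (f e.1, e.2) he
    refine ⟨(f.symm e'.1, e'.2), ?_⟩
    simpa [OppositeSide, endPoint, endDir] using he'

theorem IsTrainTrack.endDir_ne_zero (h : IsTrainTrack c) (e : B × Bool) : endDir c e ≠ 0 := by
  rcases e with ⟨b, _ | _⟩
  · simpa [endDir] using h.immersed b 0 (by simp)
  · simpa [endDir] using h.immersed b 1 (by simp)

theorem IsTrainTrack.not_sameSide_and_oppositeSide (h : IsTrainTrack c) (e e' : B × Bool)
    (h1 : SameSide c e e') (h2 : OppositeSide c e e') : False := by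
  have h3 := h1.2.symm.trans h2.2 fun h0 => absurd h0 (h.endDir_ne_zero e)
  exact h.endDir_ne_zero e' (eq_zero_of_sameRay_self_neg h3)

/-- The ends on the boundary are determined by the incidence relation. -/
theorem IsTrainTrack.mem_boundary_iff_incidence (h : IsTrainTrack c) (e : B × Bool) :
    endPoint c e ∈ connectorBoundary ↔ ∀ e', endPoint c e' = endPoint c e → e' = e := by
  refine ⟨fun he e' => h.boundary_inj e e' he, fun he => ?_⟩
  by_contra hb
  -- An end at an interior switch has a partner on the other side; if the end is alone at its point,
  -- it would be opposite to itself.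
  obtain ⟨e', he'⟩ := h.two_sided e hb
  obtain rfl := he e' he'.1
  exact h.not_sameSide_and_oppositeSide e' e' ⟨rfl, SameRay.refl _⟩ he'

end Curves

namespace TrainTrack

variable {σ σ' τ τ' : TrainTrack}

/-- Two train tracks whose branches are the same subsets of the annulus are isotopic. -/
def Isotopy.const (e : σ.Branch ≃ τ.Branch)
    (h : ∀ b, σ.curve b '' Icc 0 1 = τ.curve (e b) '' Icc 0 1) : Isotopy σ τ where
  family _ := σ.curve
  branchEquiv := e
  isTrainTrack _ _ := σ.isTrainTrack
  continuousOn b :=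
    ((σ.isTrainTrack.contDiff b).continuous.comp continuous_snd).continuousOn
  continuousOn_deriv b :=
    (((σ.isTrainTrack.contDiff b).continuous_deriv le_rfl).comp continuous_snd).continuousOn
  incidence _ _ _ _ := Iff.rfl
  start _ _ _ := rfl
  finish := h

/-- Sub-train-tracks of sub-train-tracks have nested subtypes as branch types; this moves isotopies
between the different names of the same curves. -/
def Isotopy.reindex (φ : Isotopy σ τ) (f : σ'.Branch ≃ σ.Branch)
    (hf : ∀ b, σ'.curve b = σ.curve (f b)) (g : τ.Branch ≃ τ'.Branch)
    (hg : ∀ b, τ'.curve (g b) = τ.curve b) : Isotopy σ' τ' where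
  family s b := φ.family s (f b)
  branchEquiv := (f.trans φ.branchEquiv).trans g
  isTrainTrack s hs := (φ.isTrainTrack s hs).comp_equiv f
  continuousOn b := φ.continuousOn (f b)
  continuousOn_deriv b := φ.continuousOn_deriv (f b)
  incidence s hs e e' := by
    have := φ.incidence s hs (f e.1, e.2) (f e'.1, e'.2)
    simpa [endPoint, hf] using this
  start b u hu := by rw [φ.start (f b) u hu, hf]
  finish b := by simp [φ.finish (f b), hg]

theorem IsFull.reindex (h : σ.IsFull) (f : σ'.Branch ≃ σ.Branch)
    (hf : ∀ b, σ'.curve b = σ.curve (f b)) : σ'.IsFull := by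
  classical
  obtain ⟨w, ⟨hw0, hw⟩, hpos⟩ := h
  refine ⟨fun b => w (f b), ⟨fun b => hw0 _, fun e he => ?_⟩, fun b => hpos _⟩
  have he' : endPoint σ.curve (f e.1, e.2) ∉ connectorBoundary := by
    simpa [endPoint, hf] using he
  have := hw (f e.1, e.2) he'
  rw [Finset.sum_filter, Finset.sum_filter,
    ← (f.prodCongr (Equiv.refl Bool)).sum_comp, ← (f.prodCongr (Equiv.refl Bool)).sum_comp] at this
  rw [Finset.sum_filter, Finset.sum_filter]
  convert this using 3 <;> simp [SameSide, OppositeSide, endPoint, endDir, hf]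

theorem Isotopy.continuousOn_endPoint (φ : Isotopy σ τ) (e : σ.Branch × Bool) :
    ContinuousOn (fun s => endPoint (φ.family s) e) (Icc 0 1) := by
  have h : Continuous fun s : ℝ => (s, if e.2 then (1 : ℝ) else 0) := by fun_prop
  refine (φ.continuousOn e.1).comp h.continuousOn fun s hs => ⟨hs, ?_⟩
  dsimp only
  split_ifs <;> simp

theorem Isotopy.endPoint_family_zero (φ : Isotopy σ τ) (e : σ.Branch × Bool) :
    endPoint (φ.family 0) e = endPoint σ.curve e := by
  refine φ.start e.1 _ ?_
  split_ifs <;> simp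

/-- Boundary ends are exactly the isolated ones, and incidence is constant, so the end stays on
`∂Q`. Its norm is then a continuous function with only two possible values. -/
theorem Isotopy.norm_endPoint_family (φ : Isotopy σ τ) (e : σ.Branch × Bool)
    (he : endPoint σ.curve e ∈ connectorBoundary) :
    ‖endPoint (φ.family 1) e‖ = ‖endPoint σ.curve e‖ := by
  have h1 : MapsTo (fun s => ‖endPoint (φ.family s) e‖) (Icc (0 : ℝ) 1)
      {Real.exp 1, Real.exp (-1)} := fun s hs => by
    have h2 : endPoint (φ.family s) e ∈ connectorBoundary := by
      rw [(φ.isTrainTrack s hs).mem_boundary_iff_incidence]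
      intro e' he'
      exact σ.isTrainTrack.boundary_inj e e' he ((φ.incidence s hs e' e).1 he')
    exact h2
  rw [← φ.endPoint_family_zero]
  exact isPreconnected_Icc.constant_of_mapsTo (Set.toFinite _).isDiscrete
    (φ.continuousOn_endPoint e).norm h1 (right_mem_Icc.2 zero_le_one) (left_mem_Icc.2 zero_le_one)

end TrainTrack

/-! ### Winding of curves around the origin -/

section Winding

open intervalIntegral

theorem continuousOn_integral_logDeriv {F : ℝ → ℝ → ℂ}
    (hF : ContinuousOn (fun p : ℝ × ℝ => F p.1 p.2) (Icc (0 : ℝ) 1 ×ˢ Icc (0 : ℝ) 1))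
    (hF' : ContinuousOn (fun p : ℝ × ℝ => deriv (F p.1) p.2) (Icc (0 : ℝ) 1 ×ˢ Icc (0 : ℝ) 1))
    (h0 : ∀ s ∈ Icc (0 : ℝ) 1, ∀ u ∈ Icc (0 : ℝ) 1, F s u ≠ 0) :
    ContinuousOn (fun s => ∫ u in (0 : ℝ)..1, deriv (F s) u / F s u) (Icc 0 1) := by
  -- The family is controlled only on the unit square; clamping both variables gives a globally
  -- continuous integrand that agrees with the given one there.
  let p : ℝ → ℝ := fun x => projIcc (0 : ℝ) 1 zero_le_one x
  have hp : Continuous p := continuous_subtype_val.comp continuous_projIcc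
  have hm : ∀ x, p x ∈ Icc (0 : ℝ) 1 := fun x => (projIcc (0 : ℝ) 1 zero_le_one x).2
  have hx : ∀ x ∈ Icc (0 : ℝ) 1, p x = x := fun x hx => by simp [p, projIcc_of_mem _ hx]
  have hG : Continuous fun q : ℝ × ℝ => deriv (F (p q.1)) (p q.2) / F (p q.1) (p q.2) := by
    have := (hF'.div hF fun q hq => h0 _ hq.1 _ hq.2).comp_continuous
      (f := fun q : ℝ × ℝ => (p q.1, p q.2)) (by fun_prop) fun q => ⟨hm _, hm _⟩
    exact this
  refine (continuous_parametric_intervalIntegral_of_continuous'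
    (μ := MeasureTheory.volume)
    (f := fun s u => deriv (F (p s)) (p u) / F (p s) (p u)) hG 0 1).continuousOn.congr
    fun s hs => ?_
  refine integral_congr fun u hu => ?_
  rw [uIcc_of_le zero_le_one] at hu
  simp only [hx s hs, hx u hu]

theorem continuousOn_logDeriv {f : ℝ → ℂ} (hf : ContDiff ℝ 1 f)
    (h0 : ∀ u ∈ Icc (0 : ℝ) 1, f u ≠ 0) :
    ContinuousOn (fun u => deriv f u / f u) (Icc 0 1) :=
  (hf.continuous_deriv le_rfl).continuousOn.div hf.continuous.continuousOn h0

/-- The product of `f` and `exp (-∫ f'/f)` has derivative zero on `[0, 1]`, so its values at `0` and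
`1` agree. No branch of the logarithm is needed. -/
theorem exp_integral_logDeriv {f : ℝ → ℂ} (hf : ContDiff ℝ 1 f)
    (h0 : ∀ u ∈ Icc (0 : ℝ) 1, f u ≠ 0) :
    Complex.exp (∫ u in (0 : ℝ)..1, deriv f u / f u) = f 1 / f 0 := by
  -- The constant extension beyond `[0, 1]` is continuous everywhere, so its primitive is
  -- differentiable also at the end points.
  set q : ℝ → ℂ := IccExtend zero_le_one ((Icc (0 : ℝ) 1).domRestrict fun u => deriv f u / f u)
  have hq : Continuous q := (continuousOn_logDeriv hf h0).domRestrict.Icc_extend'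
  have hqu : ∀ u ∈ Icc (0 : ℝ) 1, q u = deriv f u / f u := fun u hu => by
    simp [q, IccExtend_of_mem _ _ hu, Set.domRestrict_apply]
  have hJ : ∀ u, HasDerivAt (fun u => ∫ x in (0 : ℝ)..u, q x) (q u) u := fun u =>
    (hq.integral_hasStrictDerivAt 0 u).hasDerivAt
  have hd : ∀ u ∈ Icc (0 : ℝ) 1,
      HasDerivAt (fun u => f u * Complex.exp (-∫ x in (0 : ℝ)..u, q x)) 0 u := fun u hu => by
    have h1 := ((hf.differentiable one_ne_zero).differentiableAt (x := u)).hasDerivAt.mul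
      (hJ u).neg.cexp
    refine h1.congr_deriv ?_
    rw [hqu u hu]
    field_simp [h0 u hu]
    ring
  have hc := constant_of_has_deriv_right_zero
    (fun u hu => (hd u hu).continuousAt.continuousWithinAt)
    (fun u hu => (hd u ⟨hu.1, hu.2.le⟩).hasDerivWithinAt) 1 (by simp)
  have hI : ∫ u in (0 : ℝ)..1, deriv f u / f u = ∫ u in (0 : ℝ)..1, q u :=
    integral_congr fun u hu => by
      rw [uIcc_of_le zero_le_one] at hu
      exact (hqu u hu).symm
  simp only [integral_same, neg_zero, Complex.exp_zero, mul_one, Complex.exp_neg] at hc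
  rw [hI, ← hc]
  field_simp [h0 1 (by simp), Complex.exp_ne_zero]

theorem integral_logDeriv_of_slitPlane {f : ℝ → ℂ} (hf : ContDiff ℝ 1 f)
    {a : ℂ} (ha : ∀ u ∈ Icc (0 : ℝ) 1, a * f u ∈ Complex.slitPlane) :
    ∫ u in (0 : ℝ)..1, deriv f u / f u = Complex.log (a * f 1) - Complex.log (a * f 0) := by
  have h0 : ∀ u ∈ Icc (0 : ℝ) 1, a ≠ 0 ∧ f u ≠ 0 := fun u hu =>
    mul_ne_zero_iff.1 (Complex.slitPlane_ne_zero (ha u hu))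
  refine integral_eq_sub_of_hasDerivAt (f := fun u => Complex.log (a * f u)) (fun u hu => ?_) ?_
  · rw [uIcc_of_le zero_le_one] at hu
    have h1 := ((hf.differentiable one_ne_zero).differentiableAt (x := u)).hasDerivAt.const_mul a
    refine (h1.clog_real (ha u hu)).congr_deriv ?_
    rw [mul_div_mul_left _ _ (h0 u hu).1]
  · refine ContinuousOn.intervalIntegrable ?_
    rw [uIcc_of_le zero_le_one]
    exact continuousOn_logDeriv hf fun u hu => (h0 u hu).2

/-- The total change of the logarithm along a half turn in the half plane `0 ≤ ε * im`. -/
theorem integral_logDeriv_halfTurn {f : ℝ → ℂ} (hf : ContDiff ℝ 1 f)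
    (h0 : ∀ u ∈ Icc (0 : ℝ) 1, f u ≠ 0) {ε δ : ℝ} (hε : ε = 1 ∨ ε = -1) (hδ : δ = 1 ∨ δ = -1)
    (him : ∀ u ∈ Icc (0 : ℝ) 1, 0 ≤ ε * δ * (f u).im) (hf0 : f 0 = δ) (hf1 : f 1 = -δ) :
    ∫ u in (0 : ℝ)..1, deriv f u / f u = ε * (Real.pi * Complex.I) := by
  -- Multiplication by `-(ε * δ) * I` rotates the half plane that contains the curve onto the closed
  -- right half plane, which without the origin lies in the domain of the principal logarithm.
  rw [integral_logDeriv_of_slitPlane (a := -(ε * δ) * Complex.I) hf, hf0, hf1]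
  · rcases hε with rfl | rfl <;> rcases hδ with rfl | rfl <;>
      simp [Complex.log_I, Complex.log_neg_I] <;> ring
  · intro u hu
    have h1 := him u hu
    rw [Complex.mem_slitPlane_iff]
    by_cases hre : (f u).re = 0
    · left
      have h2 : (f u).im ≠ 0 := fun h => h0 u hu (Complex.ext hre h)
      have h3 : ε * δ * (f u).im ≠ 0 := by
        rcases hε with rfl | rfl <;> rcases hδ with rfl | rfl <;> simpa
      have h4 := lt_of_le_of_ne h1 h3.symm
      simpa using h4
    · right
      rcases hε with rfl | rfl <;> rcases hδ with rfl | rfl <;> simpa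

end Winding

/-! ### The two standard train tracks are not isotopic by an orientation preserving matching -/

theorem endPoint_outer_true (k : Bool) :
    endPoint (connectorCurve k) (.outer, true) ∈ outerBoundary := by
  simp [endPoint, outerBoundary, norm_connectorCurve]

theorem endPoint_inner_true (k : Bool) :
    endPoint (connectorCurve k) (.inner, true) ∈ innerBoundary := by
  simp [endPoint, innerBoundary, norm_connectorCurve]

section Obstruction

variable {k k' : Bool} (φ : (connectorTrack k).Isotopy (connectorTrack k'))

open TrainTrack

theorem family_one_mem {b b' : ConnectorBranch} (hb : φ.branchEquiv b = b') {u : ℝ}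
    (hu : u ∈ Icc (0 : ℝ) 1) :
    ∃ v ∈ Icc (0 : ℝ) 1, connectorCurve k' b' v = φ.family 1 b u := by
  have h : φ.family 1 b u ∈ connectorCurve k' (φ.branchEquiv b) '' Icc 0 1 :=
    (φ.finish b) ▸ mem_image_of_mem _ hu
  rw [hb] at h
  exact h

theorem eq_outer_of_norm {b : ConnectorBranch} {v : ℝ}
    (h : ‖connectorCurve k b v‖ = Real.exp 1) : b = .outer := by
  rw [norm_connectorCurve, Real.exp_eq_exp] at h
  have := sq_nonneg v
  cases b <;> simp only at h <;> first | rfl | linarith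

theorem eq_inner_of_norm {b : ConnectorBranch} {v : ℝ}
    (h : ‖connectorCurve k b v‖ = Real.exp (-1)) : b = .inner := by
  rw [norm_connectorCurve, Real.exp_eq_exp] at h
  have := sq_nonneg v
  cases b <;> simp only at h <;> first | rfl | linarith

/-- The end on the outer circle stays on the outer circle, and in the final track only the outer arc
reaches it. -/
theorem branchEquiv_outer : φ.branchEquiv .outer = .outer := by
  obtain ⟨v, hv, h2⟩ := family_one_mem φ (b := .outer) rfl (right_mem_Icc.2 zero_le_one)
  exact eq_outer_of_norm ((congrArg norm h2).trans
    ((φ.norm_endPoint_family (.outer, true) (Or.inl (endPoint_outer_true k))).trans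
      (endPoint_outer_true k)))

theorem branchEquiv_inner : φ.branchEquiv .inner = .inner := by
  obtain ⟨v, hv, h2⟩ := family_one_mem φ (b := .inner) rfl (right_mem_Icc.2 zero_le_one)
  exact eq_inner_of_norm ((congrArg norm h2).trans
    ((φ.norm_endPoint_family (.inner, true) (Or.inr (endPoint_inner_true k))).trans
      (endPoint_inner_true k)))

theorem branchEquiv_short (hl : φ.branchEquiv .long = .long) :
    φ.branchEquiv .short = .short := by
  have h1 := branchEquiv_outer φ
  have h2 := branchEquiv_inner φ
  have hi := φ.branchEquiv.injective
  generalize hb : φ.branchEquiv .short = b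
  cases b
  · exact absurd (hi (hb.trans h1.symm)) (by simp)
  · exact absurd (hi (hb.trans h2.symm)) (by simp)
  · exact absurd (hi (hb.trans hl.symm)) (by simp)
  · rfl

/-- By constant incidence the final position of this end lies on both the long half circle and the
outer arc, and the outer arc meets the unit circle only at its parameter `0`. -/
theorem family_one_long_zero (hl : φ.branchEquiv .long = .long) :
    φ.family 1 .long 0 = 1 := by
  have h1 : φ.family 1 .long 0 = φ.family 1 .outer 0 :=
    (φ.incidence 1 (by simp) (.long, false) (.outer, false)).2
      ((long_zero k).trans (outer_zero k).symm)
  obtain ⟨u, hu, h2⟩ := family_one_mem φ hl (u := 0) (by simp)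
  obtain ⟨v, hv, h3⟩ := family_one_mem φ (branchEquiv_outer φ) (u := 0) (by simp)
  have h4 := congrArg norm (h3.trans (h1.symm.trans h2.symm))
  rw [norm_connectorCurve, norm_connectorCurve, Real.exp_eq_exp] at h4
  have h5 : v = 0 := by simpa using h4
  rw [h1, ← h3, h5, outer_zero]

theorem family_one_long_one (hl : φ.branchEquiv .long = .long) :
    φ.family 1 .long 1 = -1 := by
  have h1 : φ.family 1 .long 1 = φ.family 1 .inner 0 :=
    (φ.incidence 1 (by simp) (.long, true) (.inner, false)).2
      ((long_one k).trans (inner_zero k).symm)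
  obtain ⟨u, hu, h2⟩ := family_one_mem φ hl (u := 1) (by simp)
  obtain ⟨v, hv, h3⟩ := family_one_mem φ (branchEquiv_inner φ) (u := 0) (by simp)
  have h4 := congrArg norm (h3.trans (h1.symm.trans h2.symm))
  rw [norm_connectorCurve, norm_connectorCurve, Real.exp_eq_exp] at h4
  have h5 : v = 0 := by simpa using h4
  rw [h1, ← h3, h5, inner_zero]

theorem family_short_one (s : ℝ) (hs : s ∈ Icc (0 : ℝ) 1) :
    φ.family s .short 1 = φ.family s .long 0 :=
  (φ.incidence s hs (.short, true) (.long, false)).2 ((short_one k).trans (long_zero k).symm)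

theorem family_short_zero (s : ℝ) (hs : s ∈ Icc (0 : ℝ) 1) :
    φ.family s .short 0 = φ.family s .long 1 :=
  (φ.incidence s hs (.short, false) (.long, true)).2 ((short_zero k).trans (long_one k).symm)

theorem family_ne_zero (s : ℝ) (hs : s ∈ Icc (0 : ℝ) 1) (b : ConnectorBranch) (u : ℝ)
    (hu : u ∈ Icc (0 : ℝ) 1) : φ.family s b u ≠ 0 := by
  intro h
  have := ((φ.isTrainTrack s hs).mem_connector b u hu).1
  rw [h, norm_zero] at this
  exact absurd this (not_le.2 (Real.exp_pos _))

theorem im_half_nonneg (k : Bool) {u : ℝ} (hu : u ∈ Icc (0 : ℝ) 1) :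
    0 ≤ turn k * 1 * (connectorCurve k .long u).im ∧
      0 ≤ turn k * (-1) * (connectorCurve k .short u).im := by
  have h := sin_pi_mul_nonneg hu
  rw [im_long, im_short]
  rcases turn_cases k with hk | hk <;> simp [hk, h]

/-- The long and the short half circle form a closed loop throughout the isotopy, and it avoids the
origin because it stays in the annulus. Its winding number is a continuous integer, equal to `turn
k` at the start and to `turn k'` at the end. -/
theorem turn_eq_of_isotopy (hl : φ.branchEquiv .long = .long) : k = k' := by
  let W : ℝ → ℂ := fun s => (∫ u in (0 : ℝ)..1, deriv (φ.family s .long) u / φ.family s .long u) +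
    ∫ u in (0 : ℝ)..1, deriv (φ.family s .short) u / φ.family s .short u
  have hW : ContinuousOn W (Icc 0 1) :=
    (continuousOn_integral_logDeriv (φ.continuousOn _) (φ.continuousOn_deriv _)
      fun s hs => family_ne_zero φ s hs _).add
    (continuousOn_integral_logDeriv (φ.continuousOn _) (φ.continuousOn_deriv _)
      fun s hs => family_ne_zero φ s hs _)
  -- The exponential of `W s` is the product of the end point quotients of the two branches, which
  -- is `1` since each branch starts where the other one stops.
  have hexp : ∀ s ∈ Icc (0 : ℝ) 1, ∃ n : ℤ, W s = n * (2 * Real.pi * Complex.I) := fun s hs => by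
    rw [← Complex.exp_eq_one_iff, Complex.exp_add,
      exp_integral_logDeriv ((φ.isTrainTrack s hs).contDiff _) (family_ne_zero φ s hs _),
      exp_integral_logDeriv ((φ.isTrainTrack s hs).contDiff _) (family_ne_zero φ s hs _),
      family_short_one φ s hs, family_short_zero φ s hs]
    have h1 := family_ne_zero φ s hs .long 0 (by simp)
    have h2 := family_ne_zero φ s hs .long 1 (by simp)
    field_simp
  have hmaps : MapsTo (fun s => (W s).im / (2 * Real.pi)) (Icc 0 1) (range ((↑) : ℤ → ℝ)) :=
    fun s hs => by
      obtain ⟨n, hn⟩ := hexp s hs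
      refine ⟨n, ?_⟩
      have hp := Real.pi_ne_zero
      simp [hn]
  have hdisc : IsDiscrete (range ((↑) : ℤ → ℝ)) :=
    Int.isClosedEmbedding_coe_real.isEmbedding.isDiscrete_range
  have hconst := isPreconnected_Icc.constant_of_mapsTo hdisc
    ((Complex.continuous_im.comp_continuousOn hW).div_const _) hmaps
    (left_mem_Icc.2 zero_le_one) (right_mem_Icc.2 zero_le_one)
  -- At the end of the isotopy only the images of the branches are known, not their
  -- parametrizations. It suffices that each branch joins `1` and `-1` in the correct closed half
  -- plane; each then contributes half a turn.
  have hmain : ∀ s ∈ Icc (0 : ℝ) 1, ∀ j : Bool, φ.family s .long 0 = 1 → φ.family s .long 1 = -1 →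
      (∀ u ∈ Icc (0 : ℝ) 1, ∃ v ∈ Icc (0 : ℝ) 1,
        connectorCurve j .long v = φ.family s .long u) →
      (∀ u ∈ Icc (0 : ℝ) 1, ∃ v ∈ Icc (0 : ℝ) 1,
        connectorCurve j .short v = φ.family s .short u) →
      (W s).im / (2 * Real.pi) = turn j := by
    intro s hs j h0 h1 hlong hshort
    have e1 := integral_logDeriv_halfTurn ((φ.isTrainTrack s hs).contDiff .long)
      (family_ne_zero φ s hs _) (turn_cases j) (δ := 1) (Or.inl rfl)
      (fun u hu => by
        obtain ⟨v, hv, h⟩ := hlong u hu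
        exact h ▸ (im_half_nonneg j hv).1) (by simpa using h0) (by simpa using h1)
    have e2 := integral_logDeriv_halfTurn ((φ.isTrainTrack s hs).contDiff .short)
      (family_ne_zero φ s hs _) (turn_cases j) (δ := -1) (Or.inr rfl)
      (fun u hu => by
        obtain ⟨v, hv, h⟩ := hshort u hu
        exact h ▸ (im_half_nonneg j hv).2)
      (by simpa [family_short_zero φ s hs] using h1) (by simpa [family_short_one φ s hs] using h0)
    have hp := Real.pi_ne_zero
    have : W s = turn j * (Real.pi * Complex.I) + turn j * (Real.pi * Complex.I) :=
      congrArg₂ (· + ·) e1 e2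
    simp only [this, Complex.add_im, Complex.mul_im, Complex.ofReal_re, Complex.ofReal_im,
      Complex.I_re, Complex.I_im]
    field_simp
    ring
  have hend0 : ∀ b, ∀ u ∈ Icc (0 : ℝ) 1, φ.family 0 b u = connectorCurve k b u := φ.start
  have e0 := hmain 0 (by simp) k ((hend0 _ 0 (by simp)).trans (long_zero k))
    ((hend0 _ 1 (by simp)).trans (long_one k)) (fun u hu => ⟨u, hu, (hend0 _ _ hu).symm⟩)
    (fun u hu => ⟨u, hu, (hend0 _ _ hu).symm⟩)
  have e1 := hmain 1 (by simp) k' (family_one_long_zero φ hl) (family_one_long_one φ hl)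
    (fun u hu => family_one_mem φ hl hu)
    (fun u hu => family_one_mem φ (branchEquiv_short φ hl) hu)
  have ht : turn k = turn k' := e0.symm.trans (hconst.trans e1)
  revert ht
  cases k <;> cases k' <;> simp [turn] <;> norm_num

end Obstruction

/-! ### Weight cones of the sub-train-tracks of the standard tracks -/

/-- The ends at a switch, numbered such that ends on opposite sides of a switch have opposite
numbers. -/
def switchCode : ConnectorBranch × Bool → ℤ
  | (.outer, false) => -1
  | (.long, false) => 1
  | (.short, true) => -1
  | (.inner, false) => -2
  | (.long, true) => 2
  | (.short, false) => -2
  | (.outer, true) => 3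
  | (.inner, true) => 4

theorem endPoint_switch (k : Bool) (e : ConnectorBranch × Bool)
    (he : endPoint (connectorCurve k) e ∉ connectorBoundary) :
    switchCode e ^ 2 = 1 ∧ endPoint (connectorCurve k) e = 1 ∨
      switchCode e ^ 2 = 4 ∧ endPoint (connectorCurve k) e = -1 := by
  rw [mem_boundary_iff] at he
  rcases e with ⟨b, _ | _⟩ <;> cases b <;>
    simp [endPoint, outer_zero, inner_zero, long_zero, long_one, short_zero,
      short_one, switchCode] at he ⊢

/-- The sign of the code is the side of the switch: it is the sign of the velocity along the common
tangent line. -/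
theorem switchCode_mul_endSpeed (k : Bool) (e : ConnectorBranch × Bool)
    (he : endPoint (connectorCurve k) e ∉ connectorBoundary) :
    0 < (switchCode e : ℝ) * endSpeed e := by
  have := Real.pi_pos
  rw [mem_boundary_iff] at he
  rcases e with ⟨b, _ | _⟩ <;> cases b <;> simp [switchCode, endSpeed, this] at he ⊢

/-- The absolute value of the code names the switch. The boundary ends have codes `3` and `4`, which
no switch uses up to sign. -/
theorem endPoint_eq_iff (k : Bool) (e e' : ConnectorBranch × Bool)
    (he : endPoint (connectorCurve k) e ∉ connectorBoundary) :
    endPoint (connectorCurve k) e' = endPoint (connectorCurve k) e ↔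
      switchCode e' = switchCode e ∨ switchCode e' = -switchCode e := by
  have h1 : (1 : ℂ) ≠ -1 := by norm_num
  rw [← sq_eq_sq_iff_eq_or_eq_neg]
  by_cases he' : endPoint (connectorCurve k) e' ∈ connectorBoundary
  · have h2 : endPoint (connectorCurve k) e' ≠ endPoint (connectorCurve k) e :=
      fun h => he (h ▸ he')
    refine iff_of_false h2 ?_
    rw [mem_boundary_iff] at he'
    rcases endPoint_switch k e he with ⟨h, -⟩ | ⟨h, -⟩ <;> rw [h] <;>
      rcases he' with rfl | rfl <;> simp [switchCode]
  · rcases endPoint_switch k e he with ⟨h, h'⟩ | ⟨h, h'⟩ <;>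
      rcases endPoint_switch k e' he' with ⟨h2, h3⟩ | ⟨h2, h3⟩ <;>
      simp [h, h', h2, h3, h1, h1.symm]

theorem sameSide_or_oppositeSide_of_switchCode (k : Bool) (e e' : ConnectorBranch × Bool)
    (he : endPoint (connectorCurve k) e ∉ connectorBoundary) :
    (switchCode e' = switchCode e → SameSide (connectorCurve k) e e') ∧
      (switchCode e' = -switchCode e → OppositeSide (connectorCurve k) e e') := by
  have h1 := switchCode_mul_endSpeed k e he
  refine ⟨fun h => ?_, fun h => ?_⟩
  · have hp := (endPoint_eq_iff k e e' he).2 (Or.inl h)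
    have he' : endPoint (connectorCurve k) e' ∉ connectorBoundary := hp ▸ he
    have h2 := switchCode_mul_endSpeed k e' he'
    rw [h] at h2
    refine ⟨hp, sameRay_endDir k e e' he he' ?_⟩
    rcases pos_and_pos_or_neg_and_neg_of_mul_pos h1 with ⟨h3, h4⟩ | ⟨h3, h4⟩
    · exact mul_pos h4 ((pos_iff_pos_of_mul_pos h2).1 h3)
    · exact mul_pos_of_neg_of_neg h4 ((neg_iff_neg_of_mul_pos h2).1 h3)
  · have hp := (endPoint_eq_iff k e e' he).2 (Or.inr h)
    have he' : endPoint (connectorCurve k) e' ∉ connectorBoundary := hp ▸ he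
    have h2 := switchCode_mul_endSpeed k e' he'
    rw [h, Int.cast_neg] at h2
    refine ⟨hp, sameRay_neg_endDir k e e' he he' ?_⟩
    rcases pos_and_pos_or_neg_and_neg_of_mul_pos h1 with ⟨h3, h4⟩ | ⟨h3, h4⟩
    · exact mul_neg_of_pos_of_neg h4 ((neg_iff_neg_of_mul_pos h2).1 (by linarith))
    · exact mul_neg_of_neg_of_pos h4 ((pos_iff_pos_of_mul_pos h2).1 (by linarith))

/-- Ends with opposite codes are on opposite sides, and no pair of ends is on the same side and on
opposite sides at once. -/
theorem sameSide_iff (k : Bool) (e e' : ConnectorBranch × Bool)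
    (he : endPoint (connectorCurve k) e ∉ connectorBoundary) :
    SameSide (connectorCurve k) e e' ↔ switchCode e' = switchCode e := by
  refine ⟨fun h => ?_, (sameSide_or_oppositeSide_of_switchCode k e e' he).1⟩
  refine ((endPoint_eq_iff k e e' he).1 h.1).resolve_right fun h' => ?_
  exact (connectorCurve_isTrainTrack k).not_sameSide_and_oppositeSide e e' h
    ((sameSide_or_oppositeSide_of_switchCode k e e' he).2 h')

theorem oppositeSide_iff (k : Bool) (e e' : ConnectorBranch × Bool)
    (he : endPoint (connectorCurve k) e ∉ connectorBoundary) :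
    OppositeSide (connectorCurve k) e e' ↔ switchCode e' = -switchCode e := by
  refine ⟨fun h => ?_, (sameSide_or_oppositeSide_of_switchCode k e e' he).2⟩
  refine ((endPoint_eq_iff k e e' he).1 h.1).resolve_left fun h' => ?_
  exact (connectorCurve_isTrainTrack k).not_sameSide_and_oppositeSide e e'
    ((sameSide_or_oppositeSide_of_switchCode k e e' he).1 h') h

theorem sum_connectorBranch {M : Type*} [AddCommMonoid M] (f : ConnectorBranch → M) :
    ∑ b, f b = f .outer + f .inner + f .long + f .short := by
  have : (Finset.univ : Finset ConnectorBranch) = {.outer, .inner, .long, .short} := rfl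
  rw [this]
  simp [add_assoc]

/-- The switch conditions at both switches of a standard train track. -/
def IsBalanced (W : ConnectorBranch → ℝ) : Prop :=
  W .outer + W .short = W .long ∧ W .inner + W .short = W .long

open Classical in
theorem switch_condition_iff (k : Bool) (W : ConnectorBranch → ℝ) (e : ConnectorBranch × Bool)
    (he : endPoint (connectorCurve k) e ∉ connectorBoundary) :
    (∑ e' : ConnectorBranch × Bool with SameSide (connectorCurve k) e e', W e'.1 =
      ∑ e' : ConnectorBranch × Bool with OppositeSide (connectorCurve k) e e', W e'.1) ↔
      if switchCode e ^ 2 = 1 then W .outer + W .short = W .long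
        else W .inner + W .short = W .long := by
  simp only [sameSide_iff k e _ he, oppositeSide_iff k e _ he, Finset.sum_filter,
    Fintype.sum_prod_type, sum_connectorBranch, Fintype.sum_bool]
  rw [mem_boundary_iff] at he
  rcases e with ⟨b, _ | _⟩ <;> cases b <;> simp [switchCode] at he ⊢ <;> exact eq_comm

theorem mem_weightCone_connectorTrack (k : Bool) (W : ConnectorBranch → ℝ) :
    W ∈ (connectorTrack k).weightCone ↔ (∀ b, 0 ≤ W b) ∧ IsBalanced W := by
  classical
  refine and_congr_right fun _ => ⟨fun h => ⟨?_, ?_⟩, fun h e he => ?_⟩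
  · have hb : endPoint (connectorCurve k) (.outer, false) ∉ connectorBoundary := by
      simp [mem_boundary_iff]
    simpa [switchCode] using (switch_condition_iff k W _ hb).1 (h _ hb)
  · have hb : endPoint (connectorCurve k) (.inner, false) ∉ connectorBoundary := by
      simp [mem_boundary_iff]
    simpa [switchCode] using (switch_condition_iff k W _ hb).1 (h _ hb)
  · have := (switch_condition_iff k W e he).2 (by split_ifs; exacts [h.1, h.2])
    exact this

/-- Extension of a weight vector by zero. -/
def extend {A : Finset ConnectorBranch} (w : A → ℝ) (b : ConnectorBranch) : ℝ :=
  if h : b ∈ A then w ⟨b, h⟩ else 0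

section Sub

variable {A : Finset ConnectorBranch}

@[simp] theorem extend_coe (w : A → ℝ) (b : A) : extend w b = w b := by simp [extend]

theorem extend_of_notMem (w : A → ℝ) {b : ConnectorBranch} (hb : b ∉ A) : extend w b = 0 := by
  simp [extend, hb]

theorem extend_restrict {W : ConnectorBranch → ℝ} (hW : ∀ b, b ∉ A → W b = 0) :
    extend (fun b : A => W b) = W := by
  funext b
  by_cases hb : b ∈ A
  · simp [extend, hb]
  · simp [extend, hb, hW]

theorem sum_extend (w : A → ℝ) (p : ConnectorBranch → Prop) [DecidablePred p] :
    ∑ b : A, (if p b then w b else 0) = ∑ b, if p b then extend w b else 0 := by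
  have h1 : ∑ b : A, (if p b then w b else 0) = ∑ b : A, if p b then extend w b else 0 := by simp
  rw [h1, Finset.sum_coe_sort A fun b => if p b then extend w b else 0]
  refine Finset.sum_subset (Finset.subset_univ _) fun b _ hb => ?_
  simp [extend_of_notMem w hb]

theorem sum_prod_extend (w : A → ℝ) (p : ConnectorBranch × Bool → Prop) [DecidablePred p] :
    ∑ e : A × Bool with p (e.1, e.2), w e.1 =
      ∑ e : ConnectorBranch × Bool with p e, extend w e.1 := by
  simp only [Finset.sum_filter, Fintype.sum_prod_type_right]
  exact Finset.sum_congr rfl fun β _ => sum_extend w fun b => p (b, β)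

variable {k : Bool} (hA : (connectorTrack k).IsSubtrack A)

/-- Missing branches contribute zero to the switch sums. At a switch that no branch of `A` reaches,
the condition on the extension reads `0 + 0 = 0`, so nothing is lost or added. -/
theorem mem_weightCone_sub (w : A → ℝ) :
    w ∈ ((connectorTrack k).sub A hA).weightCone ↔
      (∀ b, 0 ≤ extend w b) ∧ IsBalanced (extend w) := by
  classical
  have hpos : (∀ b, 0 ≤ extend w b) ↔ ∀ b, 0 ≤ w b := by
    refine ⟨fun h b => by simpa using h b, fun h b => ?_⟩
    by_cases hb : b ∈ A
    · simpa [extend, hb] using h _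
    · simp [extend, hb]
  rw [hpos]
  have key : ∀ e : A × Bool, endPoint (connectorCurve k) (e.1.1, e.2) ∉ connectorBoundary →
      ((∑ e' : A × Bool with SameSide (fun b : A => connectorCurve k b) e e', w e'.1 =
      ∑ e' : A × Bool with OppositeSide (fun b : A => connectorCurve k b) e e', w e'.1) ↔
      if switchCode (e.1.1, e.2) ^ 2 = 1 then
        extend w .outer + extend w .short = extend w .long
        else extend w .inner + extend w .short = extend w .long) := fun e he => by
    rw [← switch_condition_iff k (extend w) _ he, ← sum_prod_extend, ← sum_prod_extend]
    rfl
  refine and_congr_right fun _ => ⟨fun h => ?_, fun h e he => ?_⟩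
  · have h' : ∀ b (hb : b ∈ A) β, endPoint (connectorCurve k) (b, β) ∉ connectorBoundary →
        if switchCode (b, β) ^ 2 = 1 then
        extend w .outer + extend w .short = extend w .long
        else extend w .inner + extend w .short = extend w .long := fun b hb β he =>
      (key (⟨b, hb⟩, β) he).1 (h (⟨b, hb⟩, β) he)
    -- A switch condition is available only if some end in `A` lies at that switch. Either half
    -- circle touches both switches; without them, each switch can be reached only by its own arc.
    by_cases hl : .long ∈ A
    · exact ⟨by simpa [switchCode, mem_boundary_iff] using h' .long hl false,
        by simpa [switchCode, mem_boundary_iff] using h' .long hl true⟩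
    by_cases hs : .short ∈ A
    · exact ⟨by simpa [switchCode, mem_boundary_iff] using h' .short hs true,
        by simpa [switchCode, mem_boundary_iff] using h' .short hs false⟩
    refine ⟨?_, ?_⟩
    · by_cases ho : .outer ∈ A
      · simpa [switchCode, mem_boundary_iff] using h' .outer ho false
      · simp [extend, hl, hs, ho]
    · by_cases ho : .inner ∈ A
      · simpa [switchCode, mem_boundary_iff] using h' .inner ho false
      · simp [extend, hl, hs, ho]
  · have := (key e he).2 (by split_ifs; exacts [h.1, h.2])
    exact this

theorem boundaryWeight_outer (w : A → ℝ) :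
    ((connectorTrack k).sub A hA).boundaryWeight outerBoundary w = extend w .outer := by
  classical
  have h1 : ((connectorTrack k).sub A hA).boundaryWeight outerBoundary w =
      ∑ e : ConnectorBranch × Bool with endPoint (connectorCurve k) e ∈ outerBoundary,
        extend w e.1 := by
    rw [← sum_prod_extend]
    unfold TrainTrack.boundaryWeight
    congr
  have h2 : ∀ e, endPoint (connectorCurve k) e ∈ outerBoundary ↔ e = (.outer, true) := fun e => by
    rcases e with ⟨b, _ | _⟩ <;> cases b <;>
      simp [endPoint, outerBoundary, norm_connectorCurve, eq_comm (a := (1 : ℝ))]; norm_num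
  rw [h1, Finset.sum_filter]
  simp [h2]

theorem boundaryWeight_inner (w : A → ℝ) :
    ((connectorTrack k).sub A hA).boundaryWeight innerBoundary w = extend w .inner := by
  classical
  have h1 : ((connectorTrack k).sub A hA).boundaryWeight innerBoundary w =
      ∑ e : ConnectorBranch × Bool with endPoint (connectorCurve k) e ∈ innerBoundary,
        extend w e.1 := by
    rw [← sum_prod_extend]
    unfold TrainTrack.boundaryWeight
    congr
  have h2 : ∀ e, endPoint (connectorCurve k) e ∈ innerBoundary ↔ e = (.inner, true) := fun e => by
    rcases e with ⟨b, _ | _⟩ <;> cases b <;>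
      simp [endPoint, innerBoundary, norm_connectorCurve, eq_comm (a := (1 : ℝ))]; norm_num
  rw [h1, Finset.sum_filter]
  simp [h2]

end Sub

theorem isBalanced_iff {W : ConnectorBranch → ℝ} :
    IsBalanced W ↔ W = connectorWeight (W .short) (W .outer) := by
  refine ⟨fun h => ?_, fun h => ?_⟩
  · funext b
    cases b <;> simp only [connectorWeight] <;> linarith [h.1, h.2]
  · rw [h]
    simp [IsBalanced, connectorWeight, add_comm]

theorem bijOn_connectorWeight (k : Bool) :
    BijOn (fun p : ℝ × ℝ => connectorWeight p.1 p.2)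
      {p : ℝ × ℝ | 0 ≤ p.1 ∧ 0 ≤ p.2} (connectorTrack k).weightCone := by
  refine ⟨fun p hp => ?_, fun p _ q _ h => ?_, fun W hW => ?_⟩
  · refine (mem_weightCone_connectorTrack k _).2 ⟨fun b => ?_, isBalanced_iff.2 rfl⟩
    obtain ⟨h1, h2⟩ := hp
    cases b <;> simp only [connectorWeight] <;> linarith
  · exact Prod.ext (congrFun h .short) (congrFun h .outer)
  · obtain ⟨h1, h2⟩ := (mem_weightCone_connectorTrack k W).1 hW
    exact ⟨(W .short, W .outer), ⟨h1 _, h1 _⟩, (isBalanced_iff.1 h2).symm⟩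

/-! ### Full sub-train-tracks of the standard tracks -/

theorem OppositeSide.symm {B : Type} {c : B → ℝ → ℂ} {e e' : B × Bool} (h : OppositeSide c e e') :
    OppositeSide c e' e :=
  ⟨h.1.symm, (sameRay_neg_swap.2 h.2).symm⟩

theorem oppositeSide_iff_switchCode (k : Bool) {e e' : ConnectorBranch × Bool}
    (he : e ≠ (.outer, true) ∧ e ≠ (.inner, true)) (h : switchCode e' = -switchCode e) :
    OppositeSide (connectorCurve k) e e' :=
  (oppositeSide_iff k e e' (by rw [mem_boundary_iff, not_or]; exact he)).2 h

/-- The support of a balanced weight vector is a full sub-train-track. -/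
theorem isFullSubtrack_of_isBalanced (k : Bool) {A : Finset ConnectorBranch}
    {W : ConnectorBranch → ℝ} (h0 : ∀ b, 0 ≤ W b) (hA : ∀ b, b ∈ A ↔ 0 < W b)
    (hW : IsBalanced W) : (connectorTrack k).IsFullSubtrack A := by
  have hsub : (connectorTrack k).IsSubtrack A := by
    refine (connectorCurve_isTrainTrack k).comp_injective (f := fun b : A => b.1)
      Subtype.val_injective fun e he => ?_
    have he' : (e.1.1, e.2) ≠ (.outer, true) ∧ (e.1.1, e.2) ≠ (.inner, true) := by
      rw [← not_or, ← mem_boundary_iff k]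
      exact he
    have key : ∀ b β, 0 < W b → switchCode (b, β) = -switchCode (e.1.1, e.2) →
        ∃ e', OppositeSide (fun b : A => connectorCurve k b.1) e e' := fun b β hb hc =>
      ⟨(⟨b, (hA b).2 hb⟩, β), oppositeSide_iff_switchCode k he' hc⟩
    obtain ⟨⟨b, hb⟩, β⟩ := e
    have hp := (hA b).1 hb
    obtain ⟨hW1, hW2⟩ := hW
    have hs := h0 .short
    have ho := h0 .outer
    have hi := h0 .inner
    cases b <;> cases β
    · exact key .long false (by linarith) (by simp [switchCode])
    · exact absurd rfl he'.1
    · exact key .long true (by linarith) (by simp [switchCode])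
    · exact absurd rfl he'.2
    -- Opposite to the long half circle lie an arc and the short half circle. Their weights add up
    -- to a positive number, so at least one of them is in the support.
    · rcases hs.eq_or_lt with h | h
      · exact key .outer false (by linarith) (by simp [switchCode])
      · exact key .short true h (by simp [switchCode])
    · rcases hs.eq_or_lt with h | h
      · exact key .inner false (by linarith) (by simp [switchCode])
      · exact key .short false h (by simp [switchCode])
    · exact key .long true (by linarith) (by simp [switchCode])
    · exact key .long false (by linarith) (by simp [switchCode])
  refine ⟨hsub, fun b : A => W b, (mem_weightCone_sub hsub _).2 ?_, fun b => (hA _).1 b.2⟩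
  rw [extend_restrict fun b hb => le_antisymm (not_lt.1 ((hA b).not.1 hb)) (h0 b)]
  exact ⟨h0, hW⟩

def coreBranches : Finset ConnectorBranch := {.long, .short}

def arcBranches : Finset ConnectorBranch := {.outer, .inner, .long}

theorem isFullSubtrack_core (k : Bool) : (connectorTrack k).IsFullSubtrack coreBranches := by
  refine isFullSubtrack_of_isBalanced k (W := connectorWeight 1 0) (fun b => ?_) (fun b => ?_)
    (isBalanced_iff.2 rfl) <;> cases b <;> simp [connectorWeight, coreBranches]

theorem isFullSubtrack_arc (k : Bool) : (connectorTrack k).IsFullSubtrack arcBranches := by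
  refine isFullSubtrack_of_isBalanced k (W := connectorWeight 0 1) (fun b => ?_) (fun b => ?_)
    (isBalanced_iff.2 rfl) <;> cases b <;> simp [connectorWeight, arcBranches]

theorem isFullSubtrack_univ (k : Bool) : (connectorTrack k).IsFullSubtrack
    (Finset.univ : Finset ConnectorBranch) := by
  refine isFullSubtrack_of_isBalanced k (W := connectorWeight 1 1) (fun b => ?_) (fun b => ?_)
    (isBalanced_iff.2 rfl) <;> cases b <;> norm_num [connectorWeight]

/-! ### The isotopy between the two simple arcs from the outer to the inner boundary -/

/-- The radial logarithm of the switch on an arc that crosses the annulus uniformly. -/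
def slantSwitch : ℝ := Real.pi / (Real.pi + 2)

theorem slantSwitch_pos : 0 < slantSwitch := div_pos Real.pi_pos (by linarith [Real.pi_pos])

theorem slantSwitch_lt_one : slantSwitch < 1 :=
  (div_lt_one (by linarith [Real.pi_pos])).2 (by linarith)

/-- This is the tangency condition at the switches. The angular speeds of an arc and of the long
branch have ratio `π` in absolute value, so their radial speeds `c * (1 - slantSwitch)` and `2 * c *
slantSwitch` must have the same ratio; this dictates `slantSwitch`. -/
theorem slantSwitch_eq : (1 - slantSwitch) * Real.pi = 2 * slantSwitch := by
  have := Real.pi_pos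
  rw [slantSwitch]
  field_simp
  ring

/-- For `c > 0` the switches are moved off the unit circle to the radial logarithms `± c *
slantSwitch`. The value on `short` is a placeholder, since only the branches of `arcBranches` are
used. -/
def slantHeight (c : ℝ) : ConnectorBranch → ℝ → ℝ
  | .outer, u => (1 - c) * u ^ 2 + c * (slantSwitch + (1 - slantSwitch) * u)
  | .inner, u => -((1 - c) * u ^ 2 + c * (slantSwitch + (1 - slantSwitch) * u))
  | .long, u => c * (slantSwitch * (1 - 2 * u))
  | .short, _ => 0

def slantHeightDeriv (c : ℝ) : ConnectorBranch → ℝ → ℝ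
  | .outer, u => (1 - c) * (2 * u) + c * (1 - slantSwitch)
  | .inner, u => -((1 - c) * (2 * u) + c * (1 - slantSwitch))
  | .long, _ => c * (slantSwitch * -2)
  | .short, _ => 0

def slantAngle : ConnectorBranch → ℝ → ℝ
  | .outer, u => -u
  | .inner, u => Real.pi + u
  | .long, u => Real.pi * u
  | .short, u => u

def slantAngleDeriv : ConnectorBranch → ℝ
  | .outer => -1
  | .inner => 1
  | .long => Real.pi
  | .short => 1

/-- Interpolation between the arc of a standard track (for `c = 0`, `a = ± 1`) and a radial arc
(for `c = 1`, `a = 0`). -/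
def slantCurve (c a : ℝ) (b : ConnectorBranch) (u : ℝ) : ℂ :=
  polar (slantHeight c b u) (a * slantAngle b u)

theorem hasDerivAt_slantHeight (c : ℝ) (b : ConnectorBranch) (u : ℝ) :
    HasDerivAt (slantHeight c b) (slantHeightDeriv c b u) u := by
  have hi := hasDerivAt_id u
  have hsq : HasDerivAt (fun u : ℝ => u ^ 2) (2 * u) u := by simpa using hasDerivAt_pow 2 u
  have h1 : HasDerivAt (slantHeight c .outer) (slantHeightDeriv c .outer u) u := by
    have := (hsq.const_mul (1 - c)).add
      (((hi.const_mul (1 - slantSwitch)).const_add slantSwitch).const_mul c)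
    exact this.congr_deriv (by simp [slantHeightDeriv])
  cases b
  · exact h1
  · exact h1.neg
  · have := (((hi.const_mul 2).const_sub 1).const_mul slantSwitch).const_mul c
    exact this.congr_deriv (by simp [slantHeightDeriv])
  · exact hasDerivAt_const u 0

theorem hasDerivAt_slantAngle (b : ConnectorBranch) (u : ℝ) :
    HasDerivAt (slantAngle b) (slantAngleDeriv b) u := by
  have hi := hasDerivAt_id u
  cases b
  · exact hi.neg
  · exact hi.const_add _
  · exact (hi.const_mul Real.pi).congr_deriv (by simp [slantAngleDeriv])
  · exact hi

theorem deriv_slantCurve (c a : ℝ) (b : ConnectorBranch) (u : ℝ) :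
    deriv (slantCurve c a b) u = slantCurve c a b u *
      (slantHeightDeriv c b u + (a * slantAngleDeriv b : ℝ) * Complex.I) :=
  (hasDerivAt_polar (hasDerivAt_slantHeight c b u)
    ((hasDerivAt_slantAngle b u).const_mul a)).deriv

theorem norm_slantCurve (c a : ℝ) (b : ConnectorBranch) (u : ℝ) :
    ‖slantCurve c a b u‖ = Real.exp (slantHeight c b u) := norm_polar _ _

theorem slantCurve_zero_turn (k : Bool) {b : ConnectorBranch} (hb : b ∈ arcBranches) :
    slantCurve 0 (turn k) b = connectorCurve k b := by
  funext u
  cases b <;> simp [slantCurve, connectorCurve, slantHeight, slantAngle, arcBranches] at hb ⊢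

theorem continuous_slantCurve (b : ConnectorBranch) :
    Continuous fun q : ℝ × ℝ × ℝ => slantCurve q.1 q.2.1 b q.2.2 := by
  have h1 : Continuous fun q : ℝ × ℝ × ℝ => slantHeight q.1 b q.2.2 := by
    cases b <;> simp only [slantHeight] <;> fun_prop
  have h2 : Continuous fun q : ℝ × ℝ × ℝ => slantAngle b q.2.2 := by
    cases b <;> simp only [slantAngle] <;> fun_prop
  unfold slantCurve polar
  fun_prop

theorem continuous_deriv_slantCurve (b : ConnectorBranch) :
    Continuous fun q : ℝ × ℝ × ℝ => deriv (slantCurve q.1 q.2.1 b) q.2.2 := by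
  have h1 : Continuous fun q : ℝ × ℝ × ℝ => slantHeightDeriv q.1 b q.2.2 := by
    cases b <;> simp only [slantHeightDeriv] <;> fun_prop
  have h2 := continuous_slantCurve b
  simp only [deriv_slantCurve]
  fun_prop

/-- The end points of the branches of an arc across the annulus, numbered along the boundary and
the switches. -/
def arcVertex : ConnectorBranch × Bool → ℕ
  | (.outer, false) => 0
  | (.long, false) => 0
  | (.long, true) => 1
  | (.inner, false) => 1
  | (.outer, true) => 2
  | (.inner, true) => 3
  | (.short, _) => 4

theorem slantHeight_outer_strictMono {c : ℝ} (hc : 0 < c) (hc1 : c ≤ 1) {u v : ℝ} (hu : 0 ≤ u)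
    (huv : u < v) : slantHeight c .outer u < slantHeight c .outer v := by
  simp only [slantHeight]
  have h1 : (1 - c) * u ^ 2 ≤ (1 - c) * v ^ 2 :=
    mul_le_mul_of_nonneg_left (by nlinarith) (by linarith)
  have h2 : c * ((1 - slantSwitch) * u) < c * ((1 - slantSwitch) * v) :=
    mul_lt_mul_of_pos_left (mul_lt_mul_of_pos_left huv (by linarith [slantSwitch_lt_one])) hc
  linarith

theorem slantHeight_inner (c u : ℝ) : slantHeight c .inner u = -slantHeight c .outer u := rfl

theorem slantHeight_outer_zero (c : ℝ) : slantHeight c .outer 0 = c * slantSwitch := by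
  simp [slantHeight]

theorem slantHeight_outer_one (c : ℝ) : slantHeight c .outer 1 = 1 := by
  simp [slantHeight]

section Slant

variable {c : ℝ}

theorem le_slantHeight_outer (hc : 0 < c) (hc1 : c ≤ 1) {u : ℝ} (hu : u ∈ Icc (0 : ℝ) 1) :
    c * slantSwitch ≤ slantHeight c .outer u := by
  rcases hu.1.eq_or_lt with rfl | h
  · rw [slantHeight_outer_zero]
  · rw [← slantHeight_outer_zero]
    exact (slantHeight_outer_strictMono hc hc1 le_rfl h).le

theorem slantHeight_outer_le (hc : 0 < c) (hc1 : c ≤ 1) {u : ℝ} (hu : u ∈ Icc (0 : ℝ) 1) :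
    slantHeight c .outer u ≤ 1 := by
  rcases hu.2.eq_or_lt with rfl | h
  · rw [slantHeight_outer_one]
  · rw [← slantHeight_outer_one c]
    exact (slantHeight_outer_strictMono hc hc1 hu.1 h).le

theorem abs_slantHeight_long_le (hc : 0 < c) {u : ℝ} (hu : u ∈ Icc (0 : ℝ) 1) :
    |slantHeight c .long u| ≤ c * slantSwitch := by
  have h1 := mul_pos hc slantSwitch_pos
  rw [abs_le, slantHeight, ← mul_assoc]
  constructor <;> nlinarith [hu.1, hu.2]

theorem abs_slantHeight_long_lt (hc : 0 < c) {u : ℝ} (hu : u ∈ Ioo (0 : ℝ) 1) :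
    |slantHeight c .long u| < c * slantSwitch := by
  have h1 := mul_pos hc slantSwitch_pos
  rw [abs_lt, slantHeight, ← mul_assoc]
  constructor <;> nlinarith [hu.1, hu.2]

theorem mul_slantSwitch_lt_one (hc : 0 < c) (hc1 : c ≤ 1) : c * slantSwitch < 1 := by
  nlinarith [slantSwitch_pos, slantSwitch_lt_one]

theorem slantHeight_outer_inj (hc : 0 < c) (hc1 : c ≤ 1) {u v : ℝ} (hu : 0 ≤ u) (hv : 0 ≤ v)
    (h : slantHeight c .outer u = slantHeight c .outer v) : u = v := by
  rcases lt_trichotomy u v with h1 | h1 | h1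
  · exact absurd h (slantHeight_outer_strictMono hc hc1 hu h1).ne
  · exact h1
  · exact absurd h (slantHeight_outer_strictMono hc hc1 hv h1).ne'

/-- The radial logarithms of the outer, long and inner branch fill consecutive intervals, separated
at `± c * slantSwitch`, and each is strictly monotone. Hence the radial coordinate alone makes the
arc embedded, whatever its angles are. -/
theorem slantHeight_embedded (hc : 0 < c) (hc1 : c ≤ 1) {b b' : ConnectorBranch}
    (hb : b ∈ arcBranches) (hb' : b' ∈ arcBranches) {u v : ℝ} (hu : u ∈ Ioo (0 : ℝ) 1)
    (hv : v ∈ Icc (0 : ℝ) 1) (h : slantHeight c b u = slantHeight c b' v) : b = b' ∧ u = v := by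
  have hu' : u ∈ Icc (0 : ℝ) 1 := ⟨hu.1.le, hu.2.le⟩
  have hm := mul_pos hc slantSwitch_pos
  have h1 := slantHeight_outer_strictMono hc hc1 le_rfl hu.1
  rw [slantHeight_outer_zero] at h1
  have h2 := le_slantHeight_outer hc hc1 hv
  have h3 := abs_le.1 (abs_slantHeight_long_le hc hv)
  have h4 := abs_lt.1 (abs_slantHeight_long_lt hc hu)
  cases b <;> cases b' <;> try simp only [slantHeight_inner, neg_inj] at h
  · exact ⟨rfl, slantHeight_outer_inj hc hc1 hu.1.le hv.1 h⟩
  · linarith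
  · linarith
  · simp [arcBranches] at hb'
  · linarith
  · exact ⟨rfl, slantHeight_outer_inj hc hc1 hu.1.le hv.1 h⟩
  · linarith
  · simp [arcBranches] at hb'
  · linarith
  · linarith
  · refine ⟨rfl, ?_⟩
    simp only [slantHeight, ← mul_assoc] at h
    linarith [mul_left_cancel₀ hm.ne' h]
  · simp [arcBranches] at hb'
  all_goals simp [arcBranches] at hb

theorem slantHeightDeriv_ne_zero (hc : 0 < c) (hc1 : c ≤ 1) {b : ConnectorBranch}
    (hb : b ∈ arcBranches) {u : ℝ} (hu : u ∈ Icc (0 : ℝ) 1) : slantHeightDeriv c b u ≠ 0 := by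
  have h1 : 0 < (1 - c) * (2 * u) + c * (1 - slantSwitch) :=
    add_pos_of_nonneg_of_pos (mul_nonneg (by linarith) (by linarith [hu.1]))
      (mul_pos hc (by linarith [slantSwitch_lt_one]))
  cases b
  · exact h1.ne'
  · exact neg_ne_zero.2 h1.ne'
  · simp [slantHeightDeriv, hc.ne', slantSwitch_pos.ne']
  · simp [arcBranches] at hb

/-- The four vertices have the distinct radial logarithms `c * slantSwitch`, `-c * slantSwitch`, `1`
and `-1`. -/
theorem endPoint_slantCurve_eq_iff (hc : 0 < c) (hc1 : c ≤ 1) (a : ℝ)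
    {e e' : ConnectorBranch × Bool}
    (he : e.1 ∈ arcBranches) (he' : e'.1 ∈ arcBranches) :
    endPoint (slantCurve c a) e' = endPoint (slantCurve c a) e ↔ arcVertex e' = arcVertex e := by
  have hm := mul_pos hc slantSwitch_pos
  have hm1 := mul_slantSwitch_lt_one hc hc1
  have hp := slantSwitch_pos
  constructor
  · intro h
    have h := congrArg norm h
    simp only [endPoint, norm_slantCurve, Real.exp_eq_exp] at h
    rcases e with ⟨b, _ | _⟩ <;> rcases e' with ⟨b', _ | _⟩ <;> cases b <;> cases b' <;>
      simp [slantHeight, arcVertex, arcBranches, hc.ne'] at h he he' ⊢ <;> linarith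
  · intro h
    rcases e with ⟨b, _ | _⟩ <;> rcases e' with ⟨b', _ | _⟩ <;> cases b <;> cases b' <;>
      simp [endPoint, slantCurve, slantHeight, slantAngle, arcVertex, arcBranches] at h he he' ⊢ <;>
      ring_nf

theorem endPoint_slantCurve_mem_boundary_iff (hc : 0 < c) (hc1 : c ≤ 1) (a : ℝ)
    {e : ConnectorBranch × Bool} (he : e.1 ∈ arcBranches) :
    endPoint (slantCurve c a) e ∈ connectorBoundary ↔ e = (.outer, true) ∨ e = (.inner, true) := by
  have hm := mul_pos hc slantSwitch_pos
  have hm1 := mul_slantSwitch_lt_one hc hc1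
  simp only [connectorBoundary, outerBoundary, innerBoundary, mem_union, mem_ofPred_eq, endPoint,
    norm_slantCurve, Real.exp_eq_exp]
  rcases e with ⟨b, _ | _⟩ <;> cases b <;>
    simp [slantHeight, arcBranches] at he ⊢ <;> constructor <;> intro h <;> linarith

/-- By the choice of `slantSwitch`, the inward velocity of the long branch at each switch is exactly
`-π` times that of the adjacent arc. -/
theorem oppositeSide_slantCurve (a : ℝ) :
    OppositeSide (slantCurve c a) (.outer, false) (.long, false) ∧
      OppositeSide (slantCurve c a) (.inner, false) (.long, true) := by
  have hs : (1 - slantSwitch : ℂ) * Real.pi = 2 * slantSwitch := by exact_mod_cast slantSwitch_eq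
  have key : ∀ d d' : ℂ, d' = -(Real.pi * d) → SameRay ℝ d (-d') := by
    rintro d d' rfl
    rw [neg_neg, ← Complex.real_smul]
    exact SameRay.sameRay_pos_smul_right d Real.pi_pos
  have e1 : slantCurve c a .long 0 = slantCurve c a .outer 0 := by
    simp [slantCurve, slantHeight, slantAngle]
  have e2 : slantCurve c a .long 1 = slantCurve c a .inner 0 := by
    simp [slantCurve, slantHeight, slantAngle]
    ring_nf
  refine ⟨⟨e1, key _ _ ?_⟩, ⟨e2, key _ _ ?_⟩⟩
  · simp [endDir, deriv_slantCurve, e1, slantHeightDeriv, slantAngleDeriv]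
    linear_combination (slantCurve c a .outer 0) * c * hs
  · simp [endDir, deriv_slantCurve, e2, slantHeightDeriv, slantAngleDeriv]
    linear_combination (slantCurve c a .inner 0) * c * hs

theorem slantCurve_isTrainTrack (hc : 0 < c) (hc1 : c ≤ 1) (a : ℝ) :
    IsTrainTrack fun b : arcBranches => slantCurve c a b where
  contDiff b := by
    refine contDiff_polar (f := fun u => slantHeight c b u) (g := fun u => a * slantAngle b u) ?_ ?_
    · rcases b with ⟨b, hb⟩
      cases b <;> simp only [slantHeight] <;> fun_prop
    · rcases b with ⟨b, hb⟩
      cases b <;> simp only [slantAngle] <;> fun_prop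
  immersed b u hu := by
    rw [deriv_slantCurve]
    refine mul_ne_zero (polar_ne_zero _ _) fun h => slantHeightDeriv_ne_zero hc hc1 b.2 hu ?_
    simpa using congrArg Complex.re h
  mem_connector b u hu := by
    have h1 := slantHeight_outer_le hc hc1 hu
    have h2 := le_slantHeight_outer hc hc1 hu
    have h3 := abs_le.1 (abs_slantHeight_long_le hc hu)
    have hm := mul_pos hc slantSwitch_pos
    have hm1 := mul_slantSwitch_lt_one hc hc1
    simp only [connector, mem_ofPred_eq, norm_slantCurve, Real.exp_le_exp]
    rcases b with ⟨b, hb⟩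
    cases b <;> simp only [slantHeight_inner] <;> first
      | (constructor <;> linarith)
      | simp [arcBranches] at hb
  interior b u hu := by
    have hu' : u ∈ Icc (0 : ℝ) 1 := ⟨hu.1.le, hu.2.le⟩
    have h1 := slantHeight_outer_strictMono hc hc1 hu.1.le hu.2
    rw [slantHeight_outer_one] at h1
    have h2 := le_slantHeight_outer hc hc1 hu'
    have h3 := abs_le.1 (abs_slantHeight_long_le hc hu')
    have hm := mul_pos hc slantSwitch_pos
    have hm1 := mul_slantSwitch_lt_one hc hc1
    simp only [connectorBoundary, outerBoundary, innerBoundary, mem_union, mem_ofPred_eq,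
      norm_slantCurve, Real.exp_eq_exp]
    rcases b with ⟨b, hb⟩
    cases b <;> simp only [slantHeight_inner] <;> first
      | (rintro (h | h) <;> linarith)
      | simp [arcBranches] at hb
  embedded b b' u hu v hv h := by
    have hn := congrArg norm h
    rw [norm_slantCurve, norm_slantCurve, Real.exp_eq_exp] at hn
    exact (slantHeight_embedded hc hc1 b.2 b'.2 hu hv hn).imp (fun h => Subtype.ext h) id
  transverse e _ := by
    have key : ∀ (z : ℂ) (r a : ℝ), z ≠ 0 → r ≠ 0 →
        inner ℝ z (z * (r + a * Complex.I)) ≠ 0 := by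
      intro z r a hz hr
      have : inner ℝ z (z * (r + a * Complex.I)) = r * Complex.normSq z := by
        simp [Complex.inner, Complex.normSq_apply]
        ring
      rw [this]
      exact mul_ne_zero hr (by simpa using hz)
    rcases e with ⟨b, _ | _⟩
    · simp only [endPoint, endDir, if_false, deriv_slantCurve, Bool.false_eq_true]
      exact key _ _ _ (polar_ne_zero _ _) (slantHeightDeriv_ne_zero hc hc1 b.2 (by simp))
    · simp only [endPoint, endDir, if_true, deriv_slantCurve, inner_neg_right, neg_ne_zero]
      exact key _ _ _ (polar_ne_zero _ _) (slantHeightDeriv_ne_zero hc hc1 b.2 (by simp))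
  boundary_inj e e' he h := by
    have h1 := (endPoint_slantCurve_mem_boundary_iff hc hc1 a
      (e := (e.1.1, e.2)) e.1.2).1 he
    have h2 := (endPoint_slantCurve_eq_iff hc hc1 a (e := (e.1.1, e.2)) (e' := (e'.1.1, e'.2))
      e.1.2 e'.1.2).1 h
    obtain ⟨⟨b, hb⟩, β⟩ := e
    obtain ⟨⟨b', hb'⟩, β'⟩ := e'
    cases b <;> cases β <;> cases b' <;> cases β' <;> simp [arcVertex] at h1 h2 ⊢
  tangent e e' h := by
    have h2 := (endPoint_slantCurve_eq_iff hc hc1 a (e := (e.1.1, e.2)) (e' := (e'.1.1, e'.2))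
      e.1.2 e'.1.2).1 h
    obtain ⟨o1, o2⟩ := oppositeSide_slantCurve (c := c) a
    obtain ⟨⟨b, hb⟩, β⟩ := e
    obtain ⟨⟨b', hb'⟩, β'⟩ := e'
    cases b <;> cases β <;> cases b' <;> cases β' <;> simp [arcVertex] at h2 <;> first
      | exact Or.inl ⟨rfl, SameRay.refl _⟩
      | exact Or.inr o1
      | exact Or.inr o1.symm
      | exact Or.inr o2
      | exact Or.inr o2.symm
      | simp [arcBranches] at hb
  two_sided e he := by
    have h1 := (endPoint_slantCurve_mem_boundary_iff hc hc1 a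
      (e := (e.1.1, e.2)) e.1.2).not.1 he
    obtain ⟨o1, o2⟩ := oppositeSide_slantCurve (c := c) a
    have ho : ConnectorBranch.outer ∈ arcBranches := by simp [arcBranches]
    have hi : ConnectorBranch.inner ∈ arcBranches := by simp [arcBranches]
    have hl : ConnectorBranch.long ∈ arcBranches := by simp [arcBranches]
    obtain ⟨⟨b, hb⟩, β⟩ := e
    cases b <;> cases β
    · exact ⟨(⟨_, hl⟩, false), o1⟩
    · simp at h1
    · exact ⟨(⟨_, hl⟩, true), o2⟩
    · simp at h1
    · exact ⟨(⟨_, ho⟩, false), o1.symm⟩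
    · exact ⟨(⟨_, hi⟩, false), o2.symm⟩
    all_goals simp [arcBranches] at hb

end Slant

theorem endPoint_arc_eq_iff (k : Bool) {e e' : ConnectorBranch × Bool}
    (he : e.1 ∈ arcBranches) (he' : e'.1 ∈ arcBranches) :
    endPoint (connectorCurve k) e' = endPoint (connectorCurve k) e ↔
      arcVertex e' = arcVertex e := by
  by_cases hb : endPoint (connectorCurve k) e ∈ connectorBoundary
  · have h1 : endPoint (connectorCurve k) e' = endPoint (connectorCurve k) e ↔ e' = e :=
      ⟨(connectorCurve_isTrainTrack k).boundary_inj e e' hb, fun h => h ▸ rfl⟩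
    rw [h1]
    rcases (mem_boundary_iff k e).1 hb with rfl | rfl <;> rcases e' with ⟨b', _ | _⟩ <;>
      cases b' <;> simp [arcVertex]
  · rw [endPoint_eq_iff k e e' hb]
    rw [mem_boundary_iff] at hb
    rcases e with ⟨b, _ | _⟩ <;> rcases e' with ⟨b', _ | _⟩ <;> cases b <;> cases b' <;>
      simp [switchCode, arcVertex, arcBranches] at hb he he' ⊢

/-- The arcs of the two standard tracks are isotopic through arcs that cross the annulus. -/
def arcIsotopy : ((connectorTrack false).sub arcBranches (isFullSubtrack_arc false).1).Isotopy
    ((connectorTrack true).sub arcBranches (isFullSubtrack_arc true).1) := by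
  have h0 : ∀ b : arcBranches, slantCurve (0 * (1 - 0)) (1 - 2 * 0) b = connectorCurve false b :=
    fun b => by
      rw [← slantCurve_zero_turn false b.2]
      simp [turn]
  have h1 : ∀ b : arcBranches, slantCurve (1 * (1 - 1)) (1 - 2 * 1) b = connectorCurve true b :=
    fun b => by
      rw [← slantCurve_zero_turn true b.2]
      norm_num [turn]
  have hs : ∀ s ∈ Icc (0 : ℝ) 1, s = 0 ∨ s = 1 ∨ 0 < s * (1 - s) ∧ s * (1 - s) ≤ 1 :=
    fun s hs => by
      rcases hs.1.eq_or_lt with h | h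
      · exact Or.inl h.symm
      rcases hs.2.eq_or_lt with h' | h'
      · exact Or.inr (Or.inl h')
      exact Or.inr (Or.inr ⟨mul_pos h (by linarith), by nlinarith⟩)
  exact
  -- The angular factor `1 - 2 * s` runs from counterclockwise to clockwise. The factor `s * (1 -
  -- s)` vanishes only at the two ends, so in between the arc is strictly monotone in the radial
  -- direction and may pass through zero turning.
  { family := fun s (b : arcBranches) => slantCurve (s * (1 - s)) (1 - 2 * s) b
    branchEquiv := Equiv.refl arcBranches
    isTrainTrack := fun s h => by
      -- At both ends the long branch lies on the unit circle and radial monotonicity fails; there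
      -- the curves are those of the standard tracks.
      rcases hs s h with rfl | rfl | ⟨h2, h3⟩
      · have := (isFullSubtrack_arc false).1
        exact (funext h0 : (fun b : arcBranches => _) = _) ▸ this
      · have := (isFullSubtrack_arc true).1
        exact (funext h1 : (fun b : arcBranches => _) = _) ▸ this
      · exact slantCurve_isTrainTrack h2 h3 _
    continuousOn := fun b => by
      have : Continuous fun p : ℝ × ℝ => (p.1 * (1 - p.1), 1 - 2 * p.1, p.2) := by fun_prop
      exact ((continuous_slantCurve _).comp this).continuousOn
    continuousOn_deriv := fun b => by
      have : Continuous fun p : ℝ × ℝ => (p.1 * (1 - p.1), 1 - 2 * p.1, p.2) := by fun_prop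
      exact ((continuous_deriv_slantCurve _).comp this).continuousOn
    incidence := fun s h (e : arcBranches × Bool) (e' : arcBranches × Bool) => by
      have key : ∀ k, (endPoint (connectorCurve k) (e.1.1, e.2) =
          endPoint (connectorCurve k) (e'.1.1, e'.2) ↔
            arcVertex (e.1.1, e.2) = arcVertex (e'.1.1, e'.2)) := fun k =>
        endPoint_arc_eq_iff k (e := (e'.1.1, e'.2)) (e' := (e.1.1, e.2)) e'.1.2 e.1.2
      refine Iff.trans ?_ (key false).symm
      rcases hs s h with rfl | rfl | ⟨h2, h3⟩
      · rw [← key false]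
        simp only [endPoint, ← h0]
      · rw [← key true]
        simp only [endPoint, ← h1]
      · exact endPoint_slantCurve_eq_iff h2 h3 _ (e := (e'.1.1, e'.2)) (e' := (e.1.1, e.2))
          e'.1.2 e.1.2
    start := fun b u _ => congrFun (h0 b) u
    finish := fun b => congrArg (· '' Icc (0 : ℝ) 1) (h1 b) }

/-! ### Closedness of the collection -/

/-- A sub-train-track of a sub-train-track is a sub-train-track of the original track with the same
curves, so a constant isotopy suffices. -/
theorem isClosedCollection_fullSubtracks {κ : Type} (τ : κ → TrainTrack) :
    IsClosedCollection (fullSubtracks τ) := by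
  refine ⟨fun i => i.2.2.2, fun i A h hfull => ?_⟩
  obtain ⟨k, A₀, h₀⟩ := i
  let ν : A₀ ↪ (τ k).Branch := Function.Embedding.subtype _
  let A' : Finset A₀ := A
  have hm : ∀ b ∈ A'.map ν, ∃ h : b ∈ A₀, (⟨b, h⟩ : A₀) ∈ A' := fun b hb => by
    obtain ⟨a, ha, rfl⟩ := Finset.mem_map.1 hb
    exact ⟨a.2, ha⟩
  let f : A' ≃ A'.map ν :=
    { toFun := fun a => ⟨a.1.1, Finset.mem_map_of_mem ν a.2⟩
      invFun := fun b => ⟨⟨b.1, (hm b.1 b.2).1⟩, (hm b.1 b.2).2⟩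
      left_inv := fun _ => rfl
      right_inv := fun _ => rfl }
  have hsub : (τ k).IsSubtrack (A'.map ν) := by
    have h1 : IsTrainTrack fun b : A' => (τ k).curve b.1.1 := h
    exact h1.comp_equiv f.symm
  refine ⟨⟨k, A'.map ν, hsub, hfull.reindex f.symm fun _ => rfl⟩,
    ⟨TrainTrack.Isotopy.const f fun _ => rfl⟩⟩

/-! ### Gluing of the cones -/

abbrev ConnectorIndex : Type :=
  Σ k, {A : Finset (connectorTrack k).Branch // (connectorTrack k).IsFullSubtrack A}

/-- A set of branches, as a subset of a larger set of branches. -/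
def restrictFinset (D A : Finset ConnectorBranch) : Finset A := D.subtype (· ∈ A)

def subEquiv {D A : Finset ConnectorBranch} (h : D ⊆ A) : restrictFinset D A ≃ D where
  toFun x := ⟨x.1.1, Finset.mem_subtype.1 x.2⟩
  invFun d := ⟨⟨d, h d.2⟩, Finset.mem_subtype.2 d.2⟩
  left_inv _ := rfl
  right_inv _ := rfl

/-- This replaces the nested subtypes in `Glue` by subsets of the four branches, with weights
compared after extension by zero. -/
theorem glue_of_isotopy {k k' : Bool} {A A' D D' : Finset ConnectorBranch}
    (hA : (connectorTrack k).IsFullSubtrack A) (hA' : (connectorTrack k').IsFullSubtrack A')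
    (hD : (connectorTrack k).IsFullSubtrack D) (hD' : (connectorTrack k').IsFullSubtrack D')
    (hDA : D ⊆ A) (hDA' : D' ⊆ A')
    (φ : ((connectorTrack k).sub D hD.1).Isotopy ((connectorTrack k').sub D' hD'.1))
    (v : A → ℝ) (w : A' → ℝ) (hv : ∀ b, b ∉ D → extend v b = 0)
    (hw : ∀ b, b ∉ D' → extend w b = 0)
    (hvw : ∀ d : D, extend w (show D' from φ.branchEquiv d).1 = extend v d) :
    Glue connectorCollection ⟨k, A, hA⟩ ⟨k', A', hA'⟩ v w := by
  have h1 : ((connectorTrack k).sub A hA.1).IsSubtrack (restrictFinset D A) :=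
    hD.1.comp_equiv (subEquiv hDA)
  have h2 : ((connectorTrack k').sub A' hA'.1).IsSubtrack (restrictFinset D' A') :=
    hD'.1.comp_equiv (subEquiv hDA')
  refine ⟨restrictFinset D A, restrictFinset D' A', h1, h2,
    φ.reindex (subEquiv hDA) (fun _ => rfl) (subEquiv hDA').symm (fun _ => rfl),
    hD.2.reindex (subEquiv hDA) fun _ => rfl, hD'.2.reindex (subEquiv hDA') fun _ => rfl,
    fun b hb => ?_, fun b hb => ?_, fun a => ?_⟩
  · have := hv (show A from b).1 fun h => hb (Finset.mem_subtype.2 h)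
    rwa [extend_coe] at this
  · have := hw (show A' from b).1 fun h => hb (Finset.mem_subtype.2 h)
    rwa [extend_coe] at this
  · have h3 := hvw (subEquiv hDA a)
    have h4 := extend_coe v (show restrictFinset D A from a).1
    have h5 := extend_coe w ((subEquiv hDA').symm (φ.branchEquiv (subEquiv hDA a))).1
    exact (h5.symm.trans h3).trans h4

/-- A weight vector on one of the tracks of the collection, extended by zero. -/
def ext (i : ConnectorIndex) (w : (connectorCollection i).Branch → ℝ) : ConnectorBranch → ℝ :=
  extend (A := i.2.1) w

def wholeIndex (k : Bool) : ConnectorIndex :=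
  ⟨k, (Finset.univ : Finset ConnectorBranch), isFullSubtrack_univ k⟩

def wholeWeight (k : Bool) (W : ConnectorBranch → ℝ) :
    (connectorCollection (wholeIndex k)).Branch → ℝ :=
  fun b : (Finset.univ : Finset ConnectorBranch) => W b

theorem ext_wholeWeight (k : Bool) (W : ConnectorBranch → ℝ) :
    ext (wholeIndex k) (wholeWeight k W) = W :=
  extend_restrict fun b hb => absurd (Finset.mem_univ b) hb

theorem mem_weightCone_iff (i : ConnectorIndex) (w : (connectorCollection i).Branch → ℝ) :
    w ∈ (connectorCollection i).weightCone ↔ (∀ b, 0 ≤ ext i w b) ∧ IsBalanced (ext i w) :=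
  mem_weightCone_sub i.2.2.1 w

theorem sum_ext (i : ConnectorIndex) (w : (connectorCollection i).Branch → ℝ) :
    ∑ b, w b = ∑ b, ext i w b := by
  have := sum_extend (A := i.2.1) w fun _ => True
  simp only [if_true] at this
  exact this

/-- The shared sub-train-track is the member itself, inside the standard track it comes from. Thus
every point of a glued space has a representative on a full standard track. -/
theorem glue_whole (i : ConnectorIndex) (w : (connectorCollection i).Branch → ℝ) :
    Glue connectorCollection i (wholeIndex i.1) w (wholeWeight i.1 (ext i w)) := by
  obtain ⟨k, A, hA⟩ := i
  refine glue_of_isotopy hA (isFullSubtrack_univ k) hA hA subset_rfl (Finset.subset_univ _)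
    (TrainTrack.Isotopy.const (Equiv.refl _) fun _ => rfl) w _ (fun b => extend_of_notMem w)
    (fun b hb => ?_) fun d => ?_
  · exact (congrFun (ext_wholeWeight k (extend w)) b).trans (extend_of_notMem w hb)
  · exact congrFun (ext_wholeWeight k (extend w)) d.1

/-- The core circles of the two standard tracks coincide, with the two half circles exchanged. -/
def coreIsotopy : ((connectorTrack false).sub coreBranches (isFullSubtrack_core false).1).Isotopy
    ((connectorTrack true).sub coreBranches (isFullSubtrack_core true).1) := by
  let e : coreBranches ≃ coreBranches :=
    Equiv.swap ⟨.long, by simp [coreBranches]⟩ ⟨.short, by simp [coreBranches]⟩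
  refine TrainTrack.Isotopy.const e ?_
  have key : ∀ b b' : ConnectorBranch,
      (∀ k u, connectorCurve k b u = connectorCurve (!k) b' (1 - u)) →
      connectorCurve false b '' Icc 0 1 = connectorCurve true b' '' Icc 0 1 := by
    intro b b' h
    apply Subset.antisymm
    · rintro _ ⟨u, hu, rfl⟩
      exact ⟨1 - u, ⟨by linarith [hu.2], by linarith [hu.1]⟩, (h false u).symm⟩
    · rintro _ ⟨u, hu, rfl⟩
      refine ⟨1 - u, ⟨by linarith [hu.2], by linarith [hu.1]⟩, ?_⟩
      rw [h false, sub_sub_cancel]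
      rfl
  -- The long half circle of one track is the short one of the other, traversed backwards.
  have hls : ∀ k u, connectorCurve k .long u = connectorCurve (!k) .short (1 - u) := fun k u => by
    apply Complex.ext
    · rw [re_long, re_short, mul_sub, mul_one, Real.cos_pi_sub, neg_neg]
    · rw [im_long, im_short, mul_sub, mul_one, Real.sin_pi_sub]
      cases k <;> simp [turn]
  have hsl : ∀ k u, connectorCurve k .short u = connectorCurve (!k) .long (1 - u) := fun k u => by
    rw [hls, Bool.not_not, sub_sub_cancel]
  intro (b : coreBranches)
  obtain ⟨b, hb⟩ := b
  change connectorCurve false b '' _ = connectorCurve true (e ⟨b, hb⟩).1 '' _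
  cases b
  · simp [coreBranches] at hb
  · simp [coreBranches] at hb
  · rw [Equiv.swap_apply_left]
    exact key _ _ hls
  · rw [Equiv.swap_apply_right]
    exact key _ _ hsl

/-- Both half circles carry the weight `t`, so their exchange by `coreIsotopy` is harmless. -/
theorem glue_core (t : ℝ) : Glue connectorCollection (wholeIndex false) (wholeIndex true)
    (wholeWeight false (connectorWeight t 0)) (wholeWeight true (connectorWeight t 0)) := by
  have h0 : ∀ b, b ∉ coreBranches → connectorWeight t 0 b = 0 := fun b hb => by
    cases b <;> simp [coreBranches, connectorWeight] at hb ⊢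
  have h1 : ∀ b, b ∈ coreBranches → connectorWeight t 0 b = t := fun b hb => by
    cases b <;> simp [coreBranches, connectorWeight] at hb ⊢
  refine glue_of_isotopy _ _ (isFullSubtrack_core false) (isFullSubtrack_core true)
    (Finset.subset_univ _) (Finset.subset_univ _) coreIsotopy _ _ (fun b hb => ?_)
    (fun b hb => ?_) fun d => ?_
  · exact (congrFun (ext_wholeWeight false _) b).trans (h0 b hb)
  · exact (congrFun (ext_wholeWeight true _) b).trans (h0 b hb)
  · refine (congrFun (ext_wholeWeight true _) _).trans (Eq.trans ?_
      (congrFun (ext_wholeWeight false _) _).symm)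
    rw [h1 _ d.2]
    exact h1 _ (Subtype.property (p := (· ∈ coreBranches)) _)

theorem glue_arc (y : ℝ) : Glue connectorCollection (wholeIndex false) (wholeIndex true)
    (wholeWeight false (connectorWeight 0 y)) (wholeWeight true (connectorWeight 0 y)) := by
  have h0 : ∀ b, b ∉ arcBranches → connectorWeight 0 y b = 0 := fun b hb => by
    cases b <;> simp [arcBranches, connectorWeight] at hb ⊢
  have h1 : ∀ b, b ∈ arcBranches → connectorWeight 0 y b = y := fun b hb => by
    cases b <;> simp [arcBranches, connectorWeight] at hb ⊢
  refine glue_of_isotopy _ _ (isFullSubtrack_arc false) (isFullSubtrack_arc true)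
    (Finset.subset_univ _) (Finset.subset_univ _) arcIsotopy _ _ (fun b hb => ?_)
    (fun b hb => ?_) fun d => ?_
  · exact (congrFun (ext_wholeWeight false _) b).trans (h0 b hb)
  · exact (congrFun (ext_wholeWeight true _) b).trans (h0 b hb)
  · refine (congrFun (ext_wholeWeight true _) _).trans (Eq.trans ?_
      (congrFun (ext_wholeWeight false _) _).symm)
    rw [h1 _ d.2]
    exact h1 _ (Subtype.property (p := (· ∈ arcBranches)) _)

/-! ### Invariants of glued weight vectors -/

theorem sum_connectorWeight (t y : ℝ) : ∑ b, connectorWeight t y b = 2 * t + 3 * y := by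
  simp [sum_connectorBranch, connectorWeight]
  ring

section Invariance

variable {i j : ConnectorIndex} {v : (connectorCollection i).Branch → ℝ}
  {w : (connectorCollection j).Branch → ℝ}

theorem ext_eq_connectorWeight (hv : v ∈ (connectorCollection i).weightCone) :
    ext i v = connectorWeight (ext i v .short) (ext i v .outer) :=
  isBalanced_iff.1 ((mem_weightCone_iff i v).1 hv).2

theorem ext_le_long (hv : v ∈ (connectorCollection i).weightCone) (b : ConnectorBranch) :
    ext i v b ≤ ext i v .long := by
  obtain ⟨h0, h1, h2⟩ := (mem_weightCone_iff i v).1 hv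
  have := h0 .short
  have := h0 .outer
  have := h0 .inner
  cases b <;> linarith

theorem ext_coe (b : (connectorCollection i).Branch) :
    ext i v (show i.2.1 from b).1 = v b := extend_coe (A := i.2.1) v b

theorem exists_of_ext_ne_zero {b : ConnectorBranch} (h : ext i v b ≠ 0) :
    ∃ hb : b ∈ i.2.1, ext i v b = v (⟨b, hb⟩ : i.2.1) := by
  by_cases hb : b ∈ i.2.1
  · exact ⟨hb, extend_coe (A := i.2.1) v ⟨b, hb⟩⟩
  · exact absurd (extend_of_notMem (A := i.2.1) v hb) h

/-- The long half circle always has the largest weight. If its weight in `w` is not zero, it equals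
the weight of a matched branch in `v`, which is at most the largest weight there. Together with
`Glue.long_le_long`, the largest weight is invariant. -/
theorem Glue.ext_long_le (h : Glue connectorCollection i j v w)
    (hv : v ∈ (connectorCollection i).weightCone) : ext j w .long ≤ ext i v .long := by
  obtain ⟨A, B, hA, hB, φ, -, -, hvA, hwB, hvw⟩ := h
  by_cases h0 : ext j w .long = 0
  · rw [h0]
    exact ((mem_weightCone_iff i v).1 hv).1 _
  obtain ⟨hb, h1⟩ := exists_of_ext_ne_zero h0
  by_cases hbB : (⟨.long, hb⟩ : j.2.1) ∈ B
  · obtain ⟨a, ha⟩ := φ.branchEquiv.surjective (⟨⟨.long, hb⟩, hbB⟩ : B)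
    have h2 := (congrArg (fun b : B => w b.1) ha).symm.trans (hvw a)
    rw [h1]
    exact (le_of_eq (h2.trans (ext_coe _).symm)).trans (ext_le_long hv _)
  · exact absurd (h1.trans (hwB _ hbB)) h0

theorem Glue.sum_eq (h : Glue connectorCollection i j v w) :
    ∑ b, ext i v b = ∑ b, ext j w b := by
  obtain ⟨A, B, hA, hB, φ, -, -, hvA, hwB, hvw⟩ := h
  rw [← sum_ext, ← sum_ext, ← Finset.sum_subset (Finset.subset_univ A) fun b _ => hvA b,
    ← Finset.sum_subset (Finset.subset_univ B) fun b _ => hwB b, ← Finset.sum_coe_sort A,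
    ← Finset.sum_coe_sort B]
  exact Fintype.sum_equiv φ.branchEquiv _ _ fun a => (hvw a).symm

theorem Glue.long_le_long (h : Glue connectorCollection i j v w)
    (hw : w ∈ (connectorCollection j).weightCone) : ext i v .long ≤ ext j w .long := by
  obtain ⟨A, B, hA, hB, φ, -, -, hvA, hwB, hvw⟩ := h
  by_cases h0 : ext i v .long = 0
  · rw [h0]
    exact ((mem_weightCone_iff j w).1 hw).1 _
  obtain ⟨hb, h1⟩ := exists_of_ext_ne_zero h0
  by_cases hbA : (⟨.long, hb⟩ : i.2.1) ∈ A
  · have h2 := hvw ⟨⟨.long, hb⟩, hbA⟩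
    rw [h1]
    exact (ge_of_eq ((ext_coe (i := j) _).trans h2)).trans (ext_le_long hw _)
  · exact absurd (h1.trans (hvA _ hbA)) h0

/-- Glued weight vectors have the same extension by zero. -/
theorem Glue.ext_eq (h : Glue connectorCollection i j v w)
    (hv : v ∈ (connectorCollection i).weightCone) (hw : w ∈ (connectorCollection j).weightCone) :
    ext i v = ext j w := by
  -- The largest weight `t + y` and the total weight `2 * t + 3 * y` are independent linear
  -- functions, so they determine `t` and `y`.
  have h1 := h.ext_long_le hv
  have h2 := h.long_le_long hw
  have h3 := h.sum_eq
  have e1 := ext_eq_connectorWeight hv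
  have e2 := ext_eq_connectorWeight hw
  generalize ext i v .short = t at e1
  generalize ext i v .outer = y at e1
  generalize ext j w .short = t' at e2
  generalize ext j w .outer = y' at e2
  rw [e1, e2] at h1 h2 h3
  rw [sum_connectorWeight, sum_connectorWeight] at h3
  simp only [connectorWeight] at h1 h2
  rw [e1, e2, show t = t' by linarith, show y = y' by linarith]

/-- Branches of a sub-train-track of a member that carries positive weights everywhere. -/
def branchEquivOfMem (i : ConnectorIndex) (A : Finset (connectorCollection i).Branch)
    (h : ∀ b, ∃ hb : b ∈ i.2.1, (⟨b, hb⟩ : i.2.1) ∈ A) : ConnectorBranch ≃ A where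
  toFun b := ⟨⟨b, (h b).1⟩, (h b).2⟩
  invFun a := (show i.2.1 from a.1).1
  left_inv _ := rfl
  right_inv _ := rfl

/-- Glued weight vectors that are positive on all branches live on the same standard track. -/
theorem Glue.index_eq (h : Glue connectorCollection i j v w)
    (hv : v ∈ (connectorCollection i).weightCone) (hw : w ∈ (connectorCollection j).weightCone)
    (hs : 0 < ext i v .short) (ho : 0 < ext i v .outer) : i.1 = j.1 := by
  have heq := h.ext_eq hv hw
  have hcw := ext_eq_connectorWeight hv
  have hpos : ∀ b, ext i v b ≠ 0 := fun b => by
    rw [hcw]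
    cases b <;> simp only [connectorWeight] <;> positivity
  obtain ⟨A, B, hA, hB, φ, -, -, hvA, hwB, hvw⟩ := h
  -- As all four weights are nonzero and weights vanish off `A`, the shared sub-train-track contains
  -- every branch; the same holds for `B`.
  have h1 : ∀ b, ∃ hb : b ∈ i.2.1, (⟨b, hb⟩ : i.2.1) ∈ A := fun b => by
    obtain ⟨hb, h2⟩ := exists_of_ext_ne_zero (hpos b)
    exact ⟨hb, by_contra fun hn => hpos b (h2.trans (hvA _ hn))⟩
  have h2 : ∀ b, ∃ hb : b ∈ j.2.1, (⟨b, hb⟩ : j.2.1) ∈ B := fun b => by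
    have h0 := hpos b
    rw [heq] at h0
    obtain ⟨hb, h2⟩ := exists_of_ext_ne_zero h0
    exact ⟨hb, by_contra fun hn => h0 (h2.trans (hwB _ hn))⟩
  let f := branchEquivOfMem i A h1
  let g := branchEquivOfMem j B h2
  let ψ : (connectorTrack i.1).Isotopy (connectorTrack j.1) :=
    φ.reindex f (fun _ => rfl) g.symm fun _ => rfl
  -- It remains to see that `long` is matched with `long`: as `t` and `y` are positive, no other
  -- branch has the weight `t + y`.
  refine turn_eq_of_isotopy ψ ?_
  have h3 := hvw (f .long)
  have h4 : ext j w (ψ.branchEquiv .long) = ext i v .long := by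
    have e1 := ext_coe (i := j) (v := w) (show B from φ.branchEquiv (f .long)).1
    have e2 := ext_coe (i := i) (v := v) (f .long).1
    exact (e1.trans h3).trans e2.symm
  rw [← heq, hcw] at h4
  revert h4
  generalize hb : ψ.branchEquiv .long = b
  change ConnectorBranch at b
  intro h4
  cases b <;> simp only [connectorWeight] at h4 <;> first | rfl | linarith

end Invariance

/-! ### Coordinates on the glued spaces -/

/-- The two quadrants are mapped onto the upper and the lower half plane. -/
def coord (k : Bool) (W : ConnectorBranch → ℝ) : ℝ × ℝ :=
  (W .short - W .outer, turn k * min (W .short) (W .outer))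

/-- The weight of the short half circle at a point of the plane. -/
def shortWeight (p : ℝ × ℝ) : ℝ := |p.2| + max p.1 0

/-- The weight of the two arcs at a point of the plane. -/
def crossWeight (p : ℝ × ℝ) : ℝ := |p.2| + max (-p.1) 0

theorem shortWeight_nonneg (p : ℝ × ℝ) : 0 ≤ shortWeight p :=
  add_nonneg (abs_nonneg _) (le_max_right _ _)

theorem crossWeight_nonneg (p : ℝ × ℝ) : 0 ≤ crossWeight p :=
  add_nonneg (abs_nonneg _) (le_max_right _ _)

theorem continuous_shortWeight : Continuous shortWeight := by
  unfold shortWeight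
  fun_prop

theorem continuous_crossWeight : Continuous crossWeight := by
  unfold crossWeight
  fun_prop

theorem abs_turn_mul (k : Bool) (x : ℝ) : |turn k * x| = |x| := by
  rcases turn_cases k with h | h <;> simp [h]

theorem shortWeight_coord (k : Bool) {W : ConnectorBranch → ℝ} (hW : ∀ b, 0 ≤ W b) :
    shortWeight (coord k W) = W .short := by
  have hs := hW .short
  have ho := hW .outer
  simp only [shortWeight, coord, abs_turn_mul, abs_of_nonneg (le_min hs ho)]
  rcases le_total (W .short) (W .outer) with h | h
  · rw [min_eq_left h, max_eq_right (by linarith), add_zero]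
  · rw [min_eq_right h, max_eq_left (by linarith)]
    ring

theorem crossWeight_coord (k : Bool) {W : ConnectorBranch → ℝ} (hW : ∀ b, 0 ≤ W b) :
    crossWeight (coord k W) = W .outer := by
  have hs := hW .short
  have ho := hW .outer
  simp only [crossWeight, coord, abs_turn_mul, abs_of_nonneg (le_min hs ho)]
  rcases le_total (W .short) (W .outer) with h | h
  · rw [min_eq_left h, max_eq_left (by linarith)]
    ring
  · rw [min_eq_right h, max_eq_right (by linarith), add_zero]

def planeWeight (p : ℝ × ℝ) : ConnectorBranch → ℝ :=
  connectorWeight (shortWeight p) (crossWeight p)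

theorem planeWeight_nonneg (p : ℝ × ℝ) (b : ConnectorBranch) : 0 ≤ planeWeight p b := by
  have := shortWeight_nonneg p
  have := crossWeight_nonneg p
  cases b <;> simp only [planeWeight, connectorWeight] <;> linarith

/-- One of the two positive parts of `± p.1` is zero, so `|p.2|` is the smaller of the two weights
and `p.1` is their difference. -/
theorem coord_planeWeight (k : Bool) (p : ℝ × ℝ) :
    coord k (planeWeight p) = (p.1, turn k * |p.2|) := by
  simp only [coord, planeWeight, connectorWeight, shortWeight, crossWeight]
  rcases le_total p.1 0 with h | h
  · rw [max_eq_right h, max_eq_left (by linarith), min_eq_left (by linarith)]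
    ring_nf
  · rw [max_eq_left h, max_eq_right (by linarith), min_eq_right (by linarith)]
    ring_nf

theorem planeWeight_coord (k : Bool) {W : ConnectorBranch → ℝ} (h0 : ∀ b, 0 ≤ W b)
    (hW : IsBalanced W) : planeWeight (coord k W) = W := by
  rw [planeWeight, shortWeight_coord k h0, crossWeight_coord k h0]
  exact (isBalanced_iff.1 hW).symm

/-- If both parameters are positive, the tracks agree. Otherwise the minimum is zero and the sign of
the second coordinate does not matter, so the coordinates agree on the shared axes in any case. -/
theorem Glue.coord_eq {i j : ConnectorIndex} {v : (connectorCollection i).Branch → ℝ}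
    {w : (connectorCollection j).Branch → ℝ} (h : Glue connectorCollection i j v w)
    (hv : v ∈ (connectorCollection i).weightCone) (hw : w ∈ (connectorCollection j).weightCone) :
    coord i.1 (ext i v) = coord j.1 (ext j w) := by
  have h1 := h.ext_eq hv hw
  obtain ⟨h0, -⟩ := (mem_weightCone_iff i v).1 hv
  by_cases h2 : 0 < ext i v .short ∧ 0 < ext i v .outer
  · rw [h1, h.index_eq hv hw h2.1 h2.2]
  · have h3 : min (ext i v .short) (ext i v .outer) = 0 := by
      refine le_antisymm ?_ (le_min (h0 _) (h0 _))
      rwa [← not_lt, lt_min_iff]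
    have h4 := h3
    rw [h1] at h4
    simp only [coord, h4, h1, mul_zero]

/-! ### Coordinates on a general glued space, covering the cones and their projectivizations -/

section Glued

/-- The disjoint union of subsets of the cones of the connector tracks, glued together. -/
abbrev GluedSpace (C : ∀ i : ConnectorIndex, Set ((connectorCollection i).Branch → ℝ)) : Type :=
  Quot fun x y : Σ i, C i => Glue connectorCollection x.1 y.1 (x.2 : _ → ℝ) (y.2 : _ → ℝ)

variable {C : ∀ i : ConnectorIndex, Set ((connectorCollection i).Branch → ℝ)}

/-- After passing to the full tracks, equal coordinates mean equal weights. If a parameter vanishes,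
the point lies on a shared axis and can be moved to the other track; otherwise the sign of the
second coordinate determines the track. The hypothesis `hCw` keeps these moves inside the given
subsets. -/
theorem GluedSpace.mk_eq_mk (hC : ∀ i, C i ⊆ (connectorCollection i).weightCone)
    (hCw : ∀ i, ∀ w ∈ C i, ∀ k, wholeWeight k (ext i w) ∈ C (wholeIndex k)) (x y : Σ i, C i)
    (h : coord x.1.1 (ext x.1 x.2) = coord y.1.1 (ext y.1 y.2)) :
    (Quot.mk _ x : GluedSpace C) = Quot.mk _ y := by
  obtain ⟨i, v, hv⟩ := x
  obtain ⟨j, w, hw⟩ := y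
  obtain ⟨hv0, hvb⟩ := (mem_weightCone_iff i v).1 (hC i hv)
  obtain ⟨hw0, hwb⟩ := (mem_weightCone_iff j w).1 (hC j hw)
  have hV : ext i v = ext j w := by
    rw [← planeWeight_coord i.1 hv0 hvb, ← planeWeight_coord j.1 hw0 hwb]
    exact congrArg planeWeight h
  have e1 : (Quot.mk _ ⟨i, v, hv⟩ : GluedSpace C) =
      Quot.mk _ ⟨wholeIndex i.1, _, hCw i v hv i.1⟩ := Quot.sound (glue_whole i v)
  have e2 : (Quot.mk _ ⟨j, w, hw⟩ : GluedSpace C) =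
      Quot.mk _ ⟨wholeIndex j.1, _, hCw j w hw j.1⟩ := Quot.sound (glue_whole j w)
  rw [e1, e2]
  have key : (Quot.mk _ ⟨wholeIndex false, _, hCw i v hv false⟩ : GluedSpace C) =
      Quot.mk _ ⟨wholeIndex true, _, hCw i v hv true⟩ ∨ i.1 = j.1 := by
    by_cases h1 : ext i v .outer = 0
    · left
      refine Quot.sound ?_
      have h2 := isBalanced_iff.1 hvb
      rw [h1] at h2
      change Glue _ _ _ (wholeWeight false (ext i v)) (wholeWeight true (ext i v))
      rw [h2]
      exact glue_core _
    by_cases h3 : ext i v .short = 0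
    · left
      refine Quot.sound ?_
      have h2 := isBalanced_iff.1 hvb
      rw [h3] at h2
      change Glue _ _ _ (wholeWeight false (ext i v)) (wholeWeight true (ext i v))
      rw [h2]
      exact glue_arc _
    right
    have h4 := congrArg Prod.snd h
    simp only [coord, ← hV] at h4
    have h5 : 0 < min (ext i v .short) (ext i v .outer) :=
      lt_min (lt_of_le_of_ne (hv0 _) (Ne.symm h3)) (lt_of_le_of_ne (hv0 _) (Ne.symm h1))
    have h6 := mul_right_cancel₀ h5.ne' h4
    revert h6
    generalize i.1 = k
    generalize j.1 = k'
    cases k <;> cases k' <;> simp [turn] <;> norm_num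
  have e3 : (Quot.mk _ ⟨wholeIndex j.1, _, hCw j w hw j.1⟩ : GluedSpace C) =
      Quot.mk _ ⟨wholeIndex j.1, _, hCw i v hv j.1⟩ := by
    congr 3
    exact congrArg _ hV.symm
  rw [e3]
  revert key
  generalize hk : i.1 = k
  generalize j.1 = k'
  intro key
  rcases key with key | rfl
  · cases k <;> cases k' <;> first | rfl | exact key | exact key.symm
  · rfl

/-- The coordinates of a point of the glued space. -/
def GluedSpace.coord (hC : ∀ i, C i ⊆ (connectorCollection i).weightCone) :
    GluedSpace C → ℝ × ℝ :=
  Quot.lift (fun x => Lam.coord x.1.1 (ext x.1 x.2)) fun x y h =>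
    h.coord_eq (hC _ x.2.2) (hC _ y.2.2)

theorem GluedSpace.coord_injective (hC : ∀ i, C i ⊆ (connectorCollection i).weightCone)
    (hCw : ∀ i, ∀ w ∈ C i, ∀ k, wholeWeight k (ext i w) ∈ C (wholeIndex k)) :
    Function.Injective (GluedSpace.coord hC) := by
  rintro ⟨x⟩ ⟨y⟩ h
  exact GluedSpace.mk_eq_mk hC hCw x y h

open Classical in
/-- The extension of weight vectors by zero, as a continuous linear map. -/
def extL (i : ConnectorIndex) (b : ConnectorBranch) :
    ((connectorCollection i).Branch → ℝ) →L[ℝ] ℝ :=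
  if h : b ∈ i.2.1 then ContinuousLinearMap.proj (R := ℝ)
    (φ := fun _ : (connectorCollection i).Branch => ℝ) (⟨b, h⟩ : i.2.1) else 0

theorem extL_apply (i : ConnectorIndex) (b : ConnectorBranch)
    (w : (connectorCollection i).Branch → ℝ) : extL i b w = ext i w b := by
  by_cases h : b ∈ i.2.1
  · rw [extL, dif_pos h]
    exact (extend_coe (A := i.2.1) w ⟨b, h⟩).symm
  · rw [extL, dif_neg h]
    exact (extend_of_notMem (A := i.2.1) w h).symm

theorem continuous_ext (i : ConnectorIndex) (b : ConnectorBranch) :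
    Continuous fun w => ext i w b :=
  (extL i b).continuous.congr fun w => extL_apply i b w

theorem GluedSpace.continuous_coord (hC : ∀ i, C i ⊆ (connectorCollection i).weightCone) :
    Continuous (GluedSpace.coord hC) := by
  refine continuous_quot_lift _ (continuous_sigma fun i => ?_)
  have h1 := (continuous_ext i .short).comp (continuous_subtype_val (p := (· ∈ C i)))
  have h2 := (continuous_ext i .outer).comp (continuous_subtype_val (p := (· ∈ C i)))
  have h3 : Continuous fun w : C i => turn i.1 * min (ext i w .short) (ext i w .outer) :=
    continuous_const.mul (h1.min h2)
  exact (h1.sub h2).prodMk h3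

end Glued

theorem wholeWeight_mem_weightCone (k : Bool) {W : ConnectorBranch → ℝ} (h0 : ∀ b, 0 ≤ W b)
    (hW : IsBalanced W) : wholeWeight k W ∈ (connectorCollection (wholeIndex k)).weightCone :=
  (mem_weightCone_iff _ _).2 (by rw [ext_wholeWeight]; exact ⟨h0, hW⟩)

theorem wholeWeight_planeWeight_mem (k : Bool) (p : ℝ × ℝ) :
    wholeWeight k (planeWeight p) ∈ (connectorCollection (wholeIndex k)).weightCone :=
  wholeWeight_mem_weightCone k (planeWeight_nonneg p) (isBalanced_iff.2 rfl)

/-! ### The homeomorphism with the plane -/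

def mlCoord : MLSpace connectorCollection → ℝ × ℝ :=
  GluedSpace.coord (C := fun i => (connectorCollection i).weightCone) fun _ => subset_rfl

theorem mlCoord_mk (i : ConnectorIndex) (w : (connectorCollection i).weightCone) :
    mlCoord (MLSpace.mk connectorCollection i w) = coord i.1 (ext i w) := rfl

theorem mlCoord_injective : Function.Injective mlCoord :=
  GluedSpace.coord_injective _ fun i w hw k =>
    wholeWeight_mem_weightCone k ((mem_weightCone_iff i w).1 hw).1 ((mem_weightCone_iff i w).1 hw).2

def planePoint (k : Bool) (p : ℝ × ℝ) : MLSpace connectorCollection :=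
  MLSpace.mk connectorCollection (wholeIndex k) ⟨_, wholeWeight_planeWeight_mem k p⟩

theorem mlCoord_planePoint (k : Bool) (p : ℝ × ℝ) :
    mlCoord (planePoint k p) = (p.1, turn k * |p.2|) := by
  rw [planePoint, mlCoord_mk, ext_wholeWeight]
  exact coord_planeWeight k p

theorem continuous_planePoint (k : Bool) : Continuous (planePoint k) := by
  have h : Continuous fun p : ℝ × ℝ => wholeWeight k (planeWeight p) := by
    have hs := continuous_shortWeight
    have hc := continuous_crossWeight
    refine continuous_pi fun b => ?_
    change Continuous fun p : ℝ × ℝ =>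
      planeWeight p (show (Finset.univ : Finset ConnectorBranch) from b).1
    generalize (show (Finset.univ : Finset ConnectorBranch) from b).1 = b
    cases b <;> simp only [planeWeight, connectorWeight] <;> fun_prop
  have h2 : Continuous fun p : ℝ × ℝ =>
      (⟨wholeIndex k, ⟨_, wholeWeight_planeWeight_mem k p⟩⟩ :
        Σ i, (connectorCollection i).weightCone) :=
    continuous_sigmaMk.comp (h.subtype_mk _)
  exact continuous_quot_mk.comp h2

theorem mlCoord_ite (p : ℝ × ℝ) :
    mlCoord (if 0 ≤ p.2 then planePoint false p else planePoint true p) = p := by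
  split_ifs with h
  · rw [mlCoord_planePoint, abs_of_nonneg h]
    simp [turn]
  · rw [mlCoord_planePoint, abs_of_neg (not_le.1 h)]
    simp [turn]

/-- The homeomorphism between the space of measured laminations and the plane. -/
def mlHomeomorph : MLSpace connectorCollection ≃ₜ ℝ × ℝ where
  toFun := mlCoord
  invFun p := if 0 ≤ p.2 then planePoint false p else planePoint true p
  left_inv x := mlCoord_injective (mlCoord_ite _)
  right_inv := mlCoord_ite
  continuous_toFun := GluedSpace.continuous_coord _
  continuous_invFun :=
    Continuous.if_le (continuous_planePoint false) (continuous_planePoint true) continuous_const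
      -- On the common boundary line of the half planes the two candidates have the same
      -- coordinates, hence are the same point.
      continuous_snd fun p hp => mlCoord_injective (by
        rw [mlCoord_planePoint, mlCoord_planePoint, ← hp, abs_zero, mul_zero, mul_zero])

/-! ### The homeomorphism with the circle -/

theorem wholeWeight_mem_projWeightCone (k : Bool) {W : ConnectorBranch → ℝ} (h0 : ∀ b, 0 ≤ W b)
    (hW : IsBalanced W) (h1 : ∑ b, W b = 1) :
    wholeWeight k W ∈ (connectorCollection (wholeIndex k)).projWeightCone :=
  ⟨wholeWeight_mem_weightCone k h0 hW, by rw [sum_ext, ext_wholeWeight, h1]⟩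

def pmlCoord : PMLSpace connectorCollection → ℝ × ℝ :=
  GluedSpace.coord (C := fun i => (connectorCollection i).projWeightCone) fun _ _ hw => hw.1

theorem continuous_pmlCoord : Continuous pmlCoord := GluedSpace.continuous_coord _

theorem pmlCoord_injective : Function.Injective pmlCoord :=
  GluedSpace.coord_injective _ fun i w hw k =>
    wholeWeight_mem_projWeightCone k ((mem_weightCone_iff i w).1 hw.1).1
      ((mem_weightCone_iff i w).1 hw.1).2 ((sum_ext i w).symm.trans hw.2)

/-- The total weight of the weight vector at a point of the plane. -/
def totalWeight (p : ℝ × ℝ) : ℝ := 2 * shortWeight p + 3 * crossWeight p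

theorem totalWeight_pmlCoord (x : PMLSpace connectorCollection) : totalWeight (pmlCoord x) = 1 := by
  obtain ⟨i, w, hw⟩ := x
  obtain ⟨h0, hb⟩ := (mem_weightCone_iff i w).1 hw.1
  change totalWeight (coord i.1 (ext i w)) = 1
  rw [totalWeight, shortWeight_coord _ h0, crossWeight_coord _ h0, ← sum_connectorWeight,
    ← isBalanced_iff.1 hb, ← sum_ext]
  exact hw.2

/-- The weights at `p` may be placed on either track; the sign of `p.2` selects the one with the
correct coordinates. -/
theorem exists_pmlCoord_eq {p : ℝ × ℝ} (hp : totalWeight p = 1) :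
    ∃ x, pmlCoord x = p := by
  have key : ∀ k, ∃ x, pmlCoord x = (p.1, turn k * |p.2|) := fun k => by
    refine ⟨Quot.mk _ ⟨wholeIndex k, wholeWeight k (planeWeight p),
      wholeWeight_mem_projWeightCone k (planeWeight_nonneg p) (isBalanced_iff.2 rfl)
        ((sum_connectorWeight _ _).trans hp)⟩, ?_⟩
    change coord k (ext (wholeIndex k) (wholeWeight k (planeWeight p))) = _
    rw [ext_wholeWeight, coord_planeWeight]
  rcases le_total 0 p.2 with h | h
  · obtain ⟨x, hx⟩ := key false
    refine ⟨x, hx.trans (Prod.ext rfl ?_)⟩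
    simp [turn, abs_of_nonneg h]
  · obtain ⟨x, hx⟩ := key true
    refine ⟨x, hx.trans (Prod.ext rfl ?_)⟩
    simp [turn, abs_of_nonpos h]

theorem totalWeight_smul {r : ℝ} (hr : 0 ≤ r) (p : ℝ × ℝ) :
    totalWeight (r • p) = r * totalWeight p := by
  have h : ∀ x : ℝ, max (r * x) 0 = r * max x 0 := fun x => by
    rw [mul_max_of_nonneg _ _ hr, mul_zero]
  simp only [totalWeight, shortWeight, crossWeight, Prod.smul_fst, Prod.smul_snd, smul_eq_mul,
    abs_mul, abs_of_nonneg hr, h, ← mul_neg]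
  ring

theorem totalWeight_pos {p : ℝ × ℝ} (hp : p ≠ 0) : 0 < totalWeight p := by
  have h1 := shortWeight_nonneg p
  have h2 := crossWeight_nonneg p
  rcases (add_nonneg h1 h2).eq_or_lt with h | h
  · refine absurd ?_ hp
    have h3 : shortWeight p = 0 := by linarith
    have h4 : crossWeight p = 0 := by linarith
    have h5 := abs_nonneg p.2
    have h6 := le_max_right p.1 0
    have h7 := le_max_left p.1 0
    have h8 := le_max_right (-p.1) 0
    have h9 := le_max_left (-p.1) 0
    simp only [shortWeight] at h3
    simp only [crossWeight] at h4
    refine Prod.ext ?_ (abs_eq_zero.1 (by linarith))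
    exact le_antisymm (show p.1 ≤ 0 by linarith) (show 0 ≤ p.1 by linarith)
  · rw [totalWeight]
    linarith

theorem totalWeight_zero : totalWeight 0 = 0 := by
  simp [totalWeight, shortWeight, crossWeight]

def pmlComplex (x : PMLSpace connectorCollection) : ℂ :=
  Complex.equivRealProdCLM.symm (pmlCoord x)

theorem pmlComplex_ne_zero (x : PMLSpace connectorCollection) : pmlComplex x ≠ 0 := by
  intro h
  have h1 : pmlCoord x = 0 := Complex.equivRealProdCLM.symm.map_eq_zero_iff.1 h
  have h2 := totalWeight_pmlCoord x
  rw [h1, totalWeight_zero] at h2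
  exact zero_ne_one h2

/-- The direction of a projective measured lamination in the plane. -/
def pmlDirection (x : PMLSpace connectorCollection) : Circle :=
  ⟨pmlComplex x / ‖pmlComplex x‖, by
    have := pmlComplex_ne_zero x
    exact mem_sphere_zero_iff_norm.2 (by simp [this])⟩

theorem continuous_pmlDirection : Continuous pmlDirection := by
  have h1 : Continuous pmlComplex :=
    Complex.equivRealProdCLM.symm.continuous.comp continuous_pmlCoord
  refine Continuous.subtype_mk (h1.div (Complex.continuous_ofReal.comp h1.norm) fun x => ?_) _
  simpa using pmlComplex_ne_zero x

/-- Points on the same ray differ by a positive factor `r`. By homogeneity their total weights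
differ by `r` as well, and both are `1`. -/
theorem pmlDirection_injective : Function.Injective pmlDirection := by
  intro x y h
  have h1 : pmlComplex x / ‖pmlComplex x‖ = pmlComplex y / ‖pmlComplex y‖ :=
    congrArg Subtype.val h
  have hx := norm_pos_iff.2 (pmlComplex_ne_zero x)
  have hy := norm_pos_iff.2 (pmlComplex_ne_zero y)
  set r := ‖pmlComplex x‖ / ‖pmlComplex y‖ with hr
  have hr0 : 0 < r := div_pos hx hy
  have h2 : pmlComplex x = r • pmlComplex y := by
    rw [Complex.real_smul, hr, Complex.ofReal_div]
    have : (‖pmlComplex x‖ : ℂ) ≠ 0 := by exact_mod_cast hx.ne'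
    rw [div_eq_iff this] at h1
    conv_lhs => rw [h1]
    ring
  have h3 : pmlCoord x = r • pmlCoord y := by
    apply Complex.equivRealProdCLM.symm.injective
    rw [map_smul]
    exact h2
  have h4 := totalWeight_pmlCoord x
  rw [h3, totalWeight_smul hr0.le, totalWeight_pmlCoord, mul_one] at h4
  rw [h4, one_smul] at h3
  exact pmlCoord_injective h3

theorem pmlDirection_surjective : Function.Surjective pmlDirection := by
  intro z
  set p := Complex.equivRealProdCLM (z : ℂ) with hp
  have hp0 : p ≠ 0 := by
    rw [hp, Ne, Complex.equivRealProdCLM.map_eq_zero_iff]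
    exact z.coe_ne_zero
  have hN := totalWeight_pos hp0
  have hN' := inv_pos.2 hN
  -- Rescaling by the positive total weight moves the given direction onto the level set of total
  -- weight `1`.
  obtain ⟨x, hx⟩ := exists_pmlCoord_eq (p := (totalWeight p)⁻¹ • p) (by
    rw [totalWeight_smul hN'.le, inv_mul_cancel₀ hN.ne'])
  refine ⟨x, Circle.ext ?_⟩
  have h1 : pmlComplex x = ((totalWeight p)⁻¹ : ℝ) * (z : ℂ) := by
    rw [pmlComplex, hx, map_smul, hp, ContinuousLinearEquiv.symm_apply_apply, Complex.real_smul]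
  change pmlComplex x / ‖pmlComplex x‖ = z
  have h2 : ((totalWeight p)⁻¹ : ℂ) ≠ 0 := by exact_mod_cast hN'.ne'
  rw [h1, norm_mul, Circle.norm_coe, mul_one, Complex.norm_real, Real.norm_of_nonneg hN'.le,
    Complex.ofReal_inv, mul_div_cancel_left₀ _ h2]

theorem isCompact_projWeightCone (i : ConnectorIndex) :
    IsCompact (connectorCollection i).projWeightCone := by
  have hclosed : IsClosed (connectorCollection i).projWeightCone := by
    have : (connectorCollection i).projWeightCone = {w | (∀ b, 0 ≤ ext i w b) ∧
        (ext i w .outer + ext i w .short = ext i w .long ∧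
          ext i w .inner + ext i w .short = ext i w .long) ∧ ∑ b, w b = 1} := by
      ext w
      refine (and_congr_left' (mem_weightCone_iff i w)).trans ?_
      exact and_assoc
    rw [this]
    have hc := continuous_ext i
    refine IsClosed.inter ?_ (IsClosed.inter (IsClosed.inter ?_ ?_) ?_)
    · have h : IsClosed {w | ∀ b, 0 ≤ ext i w b} := by
        rw [Set.ofPred_forall]
        exact isClosed_iInter fun b => isClosed_le continuous_const (hc b)
      exact h
    · exact isClosed_eq ((hc _).add (hc _)) (hc _)
    · exact isClosed_eq ((hc _).add (hc _)) (hc _)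
    · exact isClosed_eq (continuous_finsetSum _ fun b _ => continuous_apply b) continuous_const
  refine (isCompact_Icc (a := (0 : (connectorCollection i).Branch → ℝ)) (b := 1)).of_isClosed_subset
    hclosed fun w hw => ⟨fun b => hw.1.1 b, fun b => ?_⟩
  rw [Pi.one_apply, ← hw.2]
  exact Finset.single_le_sum (f := w) (fun b _ => hw.1.1 b) (Finset.mem_univ b)

instance compactSpace_PMLSpace : CompactSpace (PMLSpace connectorCollection) := by
  have : ∀ i, CompactSpace (connectorCollection i).projWeightCone := fun i =>
    isCompact_iff_compactSpace.1 (isCompact_projWeightCone i)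
  have : Finite ConnectorIndex := inferInstance
  have : CompactSpace (Σ i, (connectorCollection i).projWeightCone) := inferInstance
  exact Quot.compactSpace

/-- A continuous bijection from a compact space to a Hausdorff space; the source is a quotient of
finitely many compact polyhedra. -/
def pmlHomeomorph : PMLSpace connectorCollection ≃ₜ Circle :=
  Continuous.homeoOfEquivCompactToT2
    (f := Equiv.ofBijective pmlDirection ⟨pmlDirection_injective, pmlDirection_surjective⟩)
    continuous_pmlDirection

/-! ### Piecewise linearity -/

section Polyhedra

variable {E : Type} [NormedAddCommGroup E] [NormedSpace ℝ E]

theorem IsPolyhedron.inter {P Q : Set E} (hP : IsPolyhedron P) (hQ : IsPolyhedron Q) :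
    IsPolyhedron (P ∩ Q) := by
  classical
  obtain ⟨H, rfl⟩ := hP
  obtain ⟨K, rfl⟩ := hQ
  refine ⟨H ∪ K, ?_⟩
  ext x
  simp only [mem_inter_iff, mem_ofPred_eq, Finset.mem_union, or_imp, forall_and]

theorem isPolyhedron_le (f g : E →L[ℝ] ℝ) : IsPolyhedron {x | f x ≤ g x} := by
  refine ⟨{(f - g, 0)}, ?_⟩
  ext x
  simp

theorem isPolyhedron_eq (f g : E →L[ℝ] ℝ) : IsPolyhedron {x | f x = g x} := by
  have h : {x | f x = g x} = {x | f x ≤ g x} ∩ {x | g x ≤ f x} := by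
    ext x
    exact le_antisymm_iff
  rw [h]
  exact (isPolyhedron_le f g).inter (isPolyhedron_le g f)

end Polyhedra

theorem isPolyhedron_weightCone (i : ConnectorIndex) :
    IsPolyhedron (connectorCollection i).weightCone := by
  have h : (connectorCollection i).weightCone =
      (({w | (0 : _ →L[ℝ] ℝ) w ≤ extL i .outer w} ∩ {w | (0 : _ →L[ℝ] ℝ) w ≤ extL i .inner w}) ∩
        ({w | (0 : _ →L[ℝ] ℝ) w ≤ extL i .long w} ∩ {w | (0 : _ →L[ℝ] ℝ) w ≤ extL i .short w})) ∩
      ({w | (extL i .outer + extL i .short) w = extL i .long w} ∩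
        {w | (extL i .inner + extL i .short) w = extL i .long w}) := by
    ext w
    refine (mem_weightCone_iff i w).trans ?_
    simp only [mem_inter_iff, mem_ofPred_eq, zero_apply,
      add_apply, extL_apply, IsBalanced]
    refine and_congr_left' ⟨fun h => ⟨⟨h _, h _⟩, h _, h _⟩, fun h b => ?_⟩
    obtain ⟨⟨h1, h2⟩, h3, h4⟩ := h
    cases b <;> assumption
  rw [h]
  exact (((isPolyhedron_le _ _).inter (isPolyhedron_le _ _)).inter
    ((isPolyhedron_le _ _).inter (isPolyhedron_le _ _))).inter
    ((isPolyhedron_eq _ _).inter (isPolyhedron_eq _ _))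

/-- The only nonlinear term in the coordinates is the minimum of the short and the outer weight. It
is linear on each of the two polyhedra into which the cone is cut by comparing these weights. -/
theorem isPiecewiseLinear_mlHomeomorph_mk (i : ConnectorIndex) :
    IsPiecewiseLinear fun w : (connectorCollection i).weightCone =>
      mlHomeomorph (MLSpace.mk connectorCollection i w) := by
  classical
  have hcont : Continuous fun w : (connectorCollection i).weightCone =>
      mlHomeomorph (MLSpace.mk connectorCollection i w) :=
    mlHomeomorph.continuous.comp (continuous_quot_mk.comp continuous_sigmaMk)
  let P : Set ((connectorCollection i).Branch → ℝ) :=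
    (connectorCollection i).weightCone ∩ {w | extL i .short w ≤ extL i .outer w}
  let Q : Set ((connectorCollection i).Branch → ℝ) :=
    (connectorCollection i).weightCone ∩ {w | extL i .outer w ≤ extL i .short w}
  have key : ∀ b, ∃ L : ((connectorCollection i).Branch → ℝ) →ᵃ[ℝ] ℝ × ℝ, ∀ w,
      L w = (ext i w .short - ext i w .outer, turn i.1 * ext i w b) := fun b =>
    ⟨(((extL i .short - extL i .outer).prod (turn i.1 • extL i b) :
      ((connectorCollection i).Branch → ℝ) →L[ℝ] ℝ × ℝ) : _ →ₗ[ℝ] _).toAffineMap, fun w => by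
        simp [extL_apply]⟩
  refine ⟨hcont, {P, Q}, ?_, ?_, ?_⟩
  · intro R hR
    rcases Finset.mem_insert.1 hR with rfl | hR
    · exact (isPolyhedron_weightCone i).inter (isPolyhedron_le _ _)
    · rw [Finset.mem_singleton.1 hR]
      exact (isPolyhedron_weightCone i).inter (isPolyhedron_le _ _)
  · rw [Finset.set_biUnion_insert, Finset.set_biUnion_singleton, ← inter_union_distrib_left]
    exact inter_eq_left.2 fun w _ => by
      simp only [mem_union, mem_ofPred_eq]
      exact le_total _ _
  · intro R hR
    rcases Finset.mem_insert.1 hR with rfl | hR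
    · obtain ⟨L, hL⟩ := key .short
      refine ⟨L, fun w hw => ?_⟩
      have h1 : ext i w .short ≤ ext i w .outer := by simpa [extL_apply] using hw.2
      rw [hL]
      change coord i.1 (ext i w) = _
      rw [coord, min_eq_left h1]
    · rw [Finset.mem_singleton.1 hR]
      obtain ⟨L, hL⟩ := key .outer
      refine ⟨L, fun w hw => ?_⟩
      have h1 : ext i w .outer ≤ ext i w .short := by simpa [extL_apply] using hw.2
      rw [hL]
      change coord i.1 (ext i w) = _
      rw [coord, min_eq_right h1]

/-! ### Linearity of the inverse on the quadrants of the plane -/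

/-- The closed quadrants of the plane. -/
def quadrant (q : Bool × Bool) : Set (ℝ × ℝ) :=
  {p | (0 : _ →L[ℝ] ℝ) p ≤ (turn q.1 • ContinuousLinearMap.fst ℝ ℝ ℝ) p} ∩
    {p | (0 : _ →L[ℝ] ℝ) p ≤ (turn q.2 • ContinuousLinearMap.snd ℝ ℝ ℝ) p}

open Classical in
def quadrants : Finset (Set (ℝ × ℝ)) := Finset.univ.image quadrant

theorem isPolyhedron_of_mem_quadrants {P : Set (ℝ × ℝ)} (hP : P ∈ quadrants) : IsPolyhedron P := by
  classical
  obtain ⟨q, -, rfl⟩ := Finset.mem_image.1 hP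
  exact (isPolyhedron_le _ _).inter (isPolyhedron_le _ _)

theorem mem_quadrant {q : Bool × Bool} {p : ℝ × ℝ} :
    p ∈ quadrant q ↔ 0 ≤ turn q.1 * p.1 ∧ 0 ≤ turn q.2 * p.2 := by
  simp [quadrant]

theorem biUnion_quadrants : ⋃ P ∈ quadrants, P = univ := by
  classical
  refine eq_univ_of_forall fun p => ?_
  have h : ∀ x : ℝ, ∃ k, 0 ≤ turn k * x := fun x => by
    rcases le_total 0 x with h | h
    · exact ⟨false, by simpa [turn] using h⟩
    · exact ⟨true, by simpa [turn] using h⟩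
  obtain ⟨k, hk⟩ := h p.1
  obtain ⟨l, hl⟩ := h p.2
  exact mem_biUnion (Finset.mem_image_of_mem quadrant (Finset.mem_univ (k, l)))
    (mem_quadrant.2 ⟨hk, hl⟩)

/-- On a quadrant, the weights are linear functions. -/
def quadrantShort (q : Bool × Bool) : ℝ × ℝ →ₗ[ℝ] ℝ :=
  turn q.2 • LinearMap.snd ℝ ℝ ℝ + (if q.1 then 0 else 1 : ℝ) • LinearMap.fst ℝ ℝ ℝ

def quadrantCross (q : Bool × Bool) : ℝ × ℝ →ₗ[ℝ] ℝ :=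
  turn q.2 • LinearMap.snd ℝ ℝ ℝ + (if q.1 then -1 else 0 : ℝ) • LinearMap.fst ℝ ℝ ℝ

theorem abs_eq_of_mem_quadrant {q : Bool × Bool} {p : ℝ × ℝ} (hp : p ∈ quadrant q) :
    turn q.2 * p.2 = |p.2| := by
  rw [← abs_turn_mul q.2, abs_of_nonneg (mem_quadrant.1 hp).2]

theorem quadrantShort_apply {q : Bool × Bool} {p : ℝ × ℝ} (hp : p ∈ quadrant q) :
    quadrantShort q p = shortWeight p := by
  have h1 := (mem_quadrant.1 hp).1
  have h2 := abs_eq_of_mem_quadrant hp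
  obtain ⟨k, l⟩ := q
  cases k <;> simp [turn] at h1
  all_goals simp [quadrantShort, shortWeight, h1, ← h2]

theorem quadrantCross_apply {q : Bool × Bool} {p : ℝ × ℝ} (hp : p ∈ quadrant q) :
    quadrantCross q p = crossWeight p := by
  have h1 := (mem_quadrant.1 hp).1
  have h2 := abs_eq_of_mem_quadrant hp
  obtain ⟨k, l⟩ := q
  cases k <;> simp [turn] at h1
  all_goals simp [quadrantCross, crossWeight, h1, ← h2]

/-- The sign of the second coordinate selects the track. The map is linear on the whole plane, but
it represents the inverse coordinates only on the quadrant `q`, where the absolute value and the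
positive parts are linear. -/
def quadrantWeight (q : Bool × Bool) :
    ℝ × ℝ →ₗ[ℝ] ((connectorCollection (wholeIndex q.2)).Branch → ℝ) where
  toFun p := wholeWeight q.2 (connectorWeight (quadrantShort q p) (quadrantCross q p))
  map_add' p p' := by
    funext b
    change connectorWeight _ _ (show (Finset.univ : Finset ConnectorBranch) from b).1 =
      connectorWeight _ _ (show (Finset.univ : Finset ConnectorBranch) from b).1 +
        connectorWeight _ _ (show (Finset.univ : Finset ConnectorBranch) from b).1
    generalize (show (Finset.univ : Finset ConnectorBranch) from b).1 = b
    cases b <;> (simp only [connectorWeight, map_add]; try ring)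
  map_smul' r p := by
    funext b
    change connectorWeight _ _ (show (Finset.univ : Finset ConnectorBranch) from b).1 =
      r * connectorWeight _ _ (show (Finset.univ : Finset ConnectorBranch) from b).1
    generalize (show (Finset.univ : Finset ConnectorBranch) from b).1 = b
    cases b <;> (simp only [connectorWeight, map_smul, smul_eq_mul]; try ring)

theorem isPLHomeomorph_mlHomeomorph : IsPLHomeomorph mlHomeomorph := by
  classical
  refine ⟨isPiecewiseLinear_mlHomeomorph_mk, quadrants, fun P => isPolyhedron_of_mem_quadrants,
    biUnion_quadrants, fun P hP => ?_⟩
  obtain ⟨q, -, rfl⟩ := Finset.mem_image.1 hP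
  refine ⟨wholeIndex q.2, (quadrantWeight q).toAffineMap, fun p hp => ?_⟩
  have h1 : (quadrantWeight q).toAffineMap p = wholeWeight q.2 (planeWeight p) := by
    rw [planeWeight, ← quadrantShort_apply hp, ← quadrantCross_apply hp]
    rfl
  rw [h1]
  refine ⟨wholeWeight_planeWeight_mem q.2 p, mlHomeomorph.symm_apply_eq.2 ?_⟩
  refine Eq.trans ?_ (mlCoord_planePoint q.2 p).symm
  rw [← abs_eq_of_mem_quadrant hp, ← mul_assoc, turn_mul_self, one_mul]

/-- The weight that a measured lamination induces on either boundary circle. -/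
def mlCross (x : MLSpace connectorCollection) : ℝ := crossWeight (mlCoord x)

theorem mlCross_mk (i : ConnectorIndex) (w : (connectorCollection i).weightCone) :
    mlCross (MLSpace.mk connectorCollection i w) = ext i w .outer :=
  crossWeight_coord i.1 ((mem_weightCone_iff i w).1 w.2).1

theorem isPiecewiseLinear_crossWeight :
    IsPiecewiseLinear fun p : (univ : Set (ℝ × ℝ)) => crossWeight p := by
  classical
  refine ⟨continuous_crossWeight.comp continuous_subtype_val, quadrants,
    fun P => isPolyhedron_of_mem_quadrants, biUnion_quadrants, fun P hP => ?_⟩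
  obtain ⟨q, -, rfl⟩ := Finset.mem_image.1 hP
  exact ⟨(quadrantCross q).toAffineMap, fun p hp => (quadrantCross_apply hp).symm⟩

end Lam

theorem mainTheorem8 :
    (∀ k : Bool, BijOn (fun p : ℝ × ℝ => Lam.connectorWeight p.1 p.2)
      {p : ℝ × ℝ | 0 ≤ p.1 ∧ 0 ≤ p.2} (Lam.connectorTrack k).weightCone) ∧
    Lam.IsClosedCollection Lam.connectorCollection ∧
    Nonempty (Lam.PMLSpace Lam.connectorCollection ≃ₜ Circle) ∧
    ∃ Φ : Lam.MLSpace Lam.connectorCollection ≃ₜ ℝ × ℝ,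
      Lam.IsPLHomeomorph Φ ∧
      ∃ y : Lam.MLSpace Lam.connectorCollection → ℝ,
        (∀ i (w : (Lam.connectorCollection i).weightCone),
          y (Lam.MLSpace.mk Lam.connectorCollection i w) =
              (Lam.connectorCollection i).boundaryWeight Lam.outerBoundary w ∧
          y (Lam.MLSpace.mk Lam.connectorCollection i w) =
              (Lam.connectorCollection i).boundaryWeight Lam.innerBoundary w) ∧
        Lam.IsPiecewiseLinear (fun p : (univ : Set (ℝ × ℝ)) => y (Φ.symm p)) := by
  refine ⟨Lam.bijOn_connectorWeight, Lam.isClosedCollection_fullSubtracks _,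
    ⟨Lam.pmlHomeomorph⟩, Lam.mlHomeomorph, Lam.isPLHomeomorph_mlHomeomorph, Lam.mlCross,
    fun i w => ⟨?_, ?_⟩, ?_⟩
  · exact (Lam.mlCross_mk i w).trans (Lam.boundaryWeight_outer i.2.2.1 w.1).symm
  · refine (Lam.mlCross_mk i w).trans (Eq.trans ?_ (Lam.boundaryWeight_inner i.2.2.1 w.1).symm)
    obtain ⟨-, h1, h2⟩ := (Lam.mem_weightCone_iff i w).1 w.2
    -- Both arcs, together with the short half circle, balance the same long half circle, so their
    -- weights agree.
    exact add_right_cancel (h1.trans h2.symm)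
  · have h : ∀ p, Lam.mlCross (Lam.mlHomeomorph.symm p) = Lam.crossWeight p := fun p =>
      congrArg Lam.crossWeight (Lam.mlHomeomorph.apply_symm_apply p)
    simp only [h]
    exact Lam.isPiecewiseLinear_crossWeight
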